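/- Consider $n$ agents, $m$ projects and a total budget of $1$. Agent $i$ has a rational demand $\mathsf d^i_j\in[0,1]$ for each project $j$, where $\sum_{j=1}^m \mathsf d^i_j\le 1$ for every $i$. A vector $\mathbf x\in[0,1]^m$ is budget-feasible if $\sum_{j=1}^m x_j\le 1$, and it satisfies agent $i$ with threshold $\tau$ if $x_j\ge \mathsf d^i_j$ for at least $\tau$ projects $j$. The problem all-agents-sat$(m-1)$ asks, given $n$, $m$ and the demands (each written as a fraction in lowest terms, with numerator and denominator in binary), whether there is a budget-feasible $\mathbf x$ that satisfies all agents with threshold $\tau=m-1$. **Theorem.** There is a pseudopolynomial time algorithm that decides all-agents-sat$(m-1)$ on the instances in which every agent has total demand exactly $1$, i.e. $\sum_{j=1}^m \mathsf d^i_j=1$ for all $i$. That is, there is a single program for a random access machine with logarithmic cost that halts with the correct answer on all such instances, and whose running time is bounded by a fixed polynomial in the binary length of the input and the largest integer occurring in it. -/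

import Mathlib

/-! ## Machine model

A random access machine with logarithmic cost. The memory consists of registers and of arrays, all
holding natural numbers of unbounded size; programs are structured programs (sequencing, branching,
loops), which mention only finitely many registers and arrays. Each elementary operation is charged
one unit plus the bit lengths of the numbers (operands, indices and results) that it handles, so
that running time agrees with running time on a multitape Turing machine up to a polynomial. -/

namespace RAM

/-- A memory content: the value of each register and of each cell of each array. -/
structure State where
  var : ℕ → ℕ
  arr : ℕ → ℕ → ℕ

/-- Arithmetic terms. -/
inductive Term where
  | lit (n : ℕ)
  | var (v : ℕ)
  | arr (a : ℕ) (i : Term)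
  | add (x y : Term)
  | sub (x y : Term)
  | mul (x y : Term)
  | div (x y : Term)

/-- The value of a term. Subtraction is truncated at `0`, division is rounded down, and
division by `0` yields `0`. -/
def Term.eval (s : State) : Term → ℕ
  | .lit n => n
  | .var v => s.var v
  | .arr a i => s.arr a (i.eval s)
  | .add x y => x.eval s + y.eval s
  | .sub x y => x.eval s - y.eval s
  | .mul x y => x.eval s * y.eval s
  | .div x y => x.eval s / y.eval s

/-- The cost of evaluating a term: each node of the term is charged one unit plus the bit length of
its value, so that the operands of an operation are paid for as well. -/
def Term.cost (s : State) : Term → ℕ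
  | .lit n => 1 + n.size
  | .var v => 1 + (s.var v).size
  | .arr a i => i.cost s + (1 + (s.arr a (i.eval s)).size)
  | .add x y => x.cost s + y.cost s + (1 + (x.eval s + y.eval s).size)
  | .sub x y => x.cost s + y.cost s + (1 + (x.eval s - y.eval s).size)
  | .mul x y => x.cost s + y.cost s + (1 + (x.eval s * y.eval s).size)
  | .div x y => x.cost s + y.cost s + (1 + (x.eval s / y.eval s).size)

/-- Programs. A test succeeds when the value of the term is nonzero. -/
inductive Program where
  | skip
  | assign (v : ℕ) (x : Term)
  | store (a : ℕ) (i x : Term)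
  | seq (c₁ c₂ : Program)
  | ite (x : Term) (c₁ c₂ : Program)
  | loop (x : Term) (c : Program)

/-- The state after writing `n` into register `v`. -/
def State.setVar (s : State) (v n : ℕ) : State :=
  { s with var := Function.update s.var v n }

/-- The state after writing `n` into cell `i` of array `a`. -/
def State.setArr (s : State) (a i n : ℕ) : State :=
  { s with arr := Function.update s.arr a (Function.update (s.arr a) i n) }

/-- `Exec c s s' t`: started in state `s`, the program `c` halts in state `s'` after a
computation of cost `t`. -/
inductive Exec : Program → State → State → ℕ → Prop where
  | skip (s : State) : Exec .skip s s 1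
  | assign (v : ℕ) (x : Term) (s : State) :
      Exec (.assign v x) s (s.setVar v (x.eval s)) (x.cost s + 1)
  | store (a : ℕ) (i x : Term) (s : State) :
      Exec (.store a i x) s (s.setArr a (i.eval s) (x.eval s)) (i.cost s + x.cost s + 1)
  | seq {c₁ c₂ : Program} {s s' s'' : State} {t₁ t₂ : ℕ} :
      Exec c₁ s s' t₁ → Exec c₂ s' s'' t₂ → Exec (.seq c₁ c₂) s s'' (t₁ + t₂)
  | iteTrue {x : Term} {c₁ c₂ : Program} {s s' : State} {t : ℕ} :
      x.eval s ≠ 0 → Exec c₁ s s' t → Exec (.ite x c₁ c₂) s s' (x.cost s + 1 + t)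
  | iteFalse {x : Term} {c₁ c₂ : Program} {s s' : State} {t : ℕ} :
      x.eval s = 0 → Exec c₂ s s' t → Exec (.ite x c₁ c₂) s s' (x.cost s + 1 + t)
  | loopDone {x : Term} {c : Program} {s : State} :
      x.eval s = 0 → Exec (.loop x c) s s (x.cost s + 1)
  | loopStep {x : Term} {c : Program} {s s' s'' : State} {t₁ t₂ : ℕ} :
      x.eval s ≠ 0 → Exec c s s' t₁ → Exec (.loop x c) s' s'' t₂ →
      Exec (.loop x c) s s'' (x.cost s + 1 + t₁ + t₂)

/-- The initial state on an input: the input is in array `0`, its number of entries is in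
register `0`, and everything else is `0`. -/
def initialState (input : List ℕ) : State where
  var v := if v = 0 then input.length else 0
  arr a i := if a = 0 then input.getD i 0 else 0

/-- On the given input, the program halts within cost `t`, with answer `1` in register `0` if `P`
holds and with answer `0` if `P` fails. -/
def DecidesWithin (c : Program) (input : List ℕ) (t : ℕ) (P : Prop) : Prop :=
  ∃ (s : State) (t' : ℕ), Exec c (initialState input) s t' ∧ t' ≤ t ∧
    (P → s.var 0 = 1) ∧ (¬ P → s.var 0 = 0)

/-- The length of an input, its entries being written in binary with a separator after each. -/
def inputLength (input : List ℕ) : ℕ := (input.map fun k => k.size + 1).sum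

/-- The largest number that occurs in an input. -/
def maxNumber (input : List ℕ) : ℕ := input.foldr max 0

/-- A decision problem, with the promise that the instances are `valid`, can be decided in
pseudopolynomial time: a single program decides all valid instances, in time polynomial in
the (binary) length of the input and the largest number that occurs in it. -/
def PseudoPolyTimeDecidable {α : Type} (encode : α → List ℕ) (valid answer : α → Prop) : Prop :=
  ∃ (c : Program) (p : Polynomial ℕ), ∀ a, valid a →
    DecidesWithin c (encode a) (p.eval (inputLength (encode a) + maxNumber (encode a))) (answer a)

end RAM

/-! ## The budget division problem -/

namespace BudgetDivision

/-- An instance with `n` agents and `m` projects; `demand i j` is the demand of agent `i` for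
project `j`. The total budget is `1`. -/
structure Instance where
  n : ℕ
  m : ℕ
  demand : Fin n → Fin m → ℚ
  demand_mem : ∀ i j, demand i j ∈ Set.Icc (0 : ℚ) 1
  sum_demand_le : ∀ i, ∑ j, demand i j ≤ 1

/-- `x` is a budget-feasible solution. -/
def Instance.BudgetFeasible (I : Instance) (x : Fin I.m → ℝ) : Prop :=
  (∀ j, x j ∈ Set.Icc (0 : ℝ) 1) ∧ ∑ j, x j ≤ 1

/-- Agent `i` is satisfied by `x`: she is locally satisfied for at least `τ` projects. -/
def Instance.Satisfied (I : Instance) (τ : ℕ) (x : Fin I.m → ℝ) (i : Fin I.n) : Prop :=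
  τ ≤ Set.ncard {j : Fin I.m | (I.demand i j : ℝ) ≤ x j}

/-- Some budget-feasible solution satisfies all agents. -/
def Instance.AllAgentsSat (I : Instance) (τ : ℕ) : Prop :=
  ∃ x : Fin I.m → ℝ, I.BudgetFeasible x ∧ ∀ i, I.Satisfied τ x i

/-- Every agent has total demand exactly `1`. -/
def Instance.Tight (I : Instance) : Prop := ∀ i, ∑ j, I.demand i j = 1

/-- The input that describes an instance: `n`, `m`, and then, row by row, the numerator and the
denominator (in lowest terms) of each demand. -/
def Instance.encode (I : Instance) : List ℕ :=
  I.n :: I.m :: (List.finRange I.n).flatMap fun i =>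
    (List.finRange I.m).flatMap fun j => [(I.demand i j).num.toNat, (I.demand i j).den]

end BudgetDivision

/-!
After multiplication by the product of all denominators, which has no more bits than the input, the
demands are integers and the budget is an integer `D`. Go through the agents one by one and maintain
the list of all minimal integral solutions for the agents seen so far: the minimal solutions for one
more agent are the minimal elements, within the budget, of the vectors that arise by raising an old
minimal solution to the demands of that agent in all coordinates but one.

This list stays short. If `x ≠ y` are minimal solutions, then their infimum is not a solution, so
some agent misses only project `a` at `x` and only project `b` at `y`. If such pairs `(a, b)` occur
with both entries different, then, as the total demand of an agent is the whole budget, the two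
agents use up the budget and `y` exceeds `x` in at most two coordinates. Otherwise all pairs share
one entry, and one vector exceeds the other in a single coordinate. In any case one of the counts
`#{j | x j < y j}` and `#{j | y j < x j}` is `1` or `2`, so a product of four linear forms in
threshold indicators of `y` vanishes at all minimal solutions `y ≠ x` but not at `y = x`. These
functions are linearly independent and lie in a space of polynomial dimension. All loops have
polynomial length and all numbers polynomially many bits, so the algorithm even runs in polynomial
time.
-/

/-! ### Minimal solutions -/

namespace BudgetDivision

open Finset

/-- The vector `x` is at least `w` in all coordinates except possibly one. -/
def AlmostCovers {ι : Type*} (x w : ι → ℕ) : Prop := ∃ l, ∀ j ≠ l, w j ≤ x j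

/-- The integral version of the problem: `x` respects the budget `D` and satisfies each agent, given
by a vector of demands in `W`, for all projects except possibly one. -/
def IsSolution {ι : Type*} [Fintype ι] (W : Finset (ι → ℕ)) (D : ℕ) (x : ι → ℕ) : Prop :=
  ∑ j, x j ≤ D ∧ ∀ w ∈ W, AlmostCovers x w

/-- The vector `x` raised to `w` in all coordinates but `l`, which is the cheapest way to satisfy an
agent with demands `w` for all projects but `l`. -/
def raise {ι : Type*} [DecidableEq ι] (x w : ι → ℕ) (l : ι) : ι → ℕ :=
  Function.update (x ⊔ w) l (x l)

/-- The coordinates in which `y` exceeds `x`. -/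
def exceeds {ι : Type*} [Fintype ι] (x y : ι → ℕ) : Finset ι := {j | x j < y j}

/-- The demands `w` are a reason why the infimum of `x` and `y` is not a solution: `x` misses
only the demand for `a`, while `y` misses only the demand for `b`. -/
structure Conflict {ι : Type*} (w x y : ι → ℕ) (a b : ι) : Prop where
  ne : a ≠ b
  left_lt : x a < w a
  right_lt : y b < w b
  le_left : ∀ j ≠ a, w j ≤ x j
  le_right : ∀ j ≠ b, w j ≤ y j

section Raise

variable {ι : Type*} {x y w : ι → ℕ} {l : ι}

lemma AlmostCovers.mono (h : AlmostCovers x w) (hxy : x ≤ y) : AlmostCovers y w :=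
  h.imp fun _ hl j hj => (hl j hj).trans (hxy j)

variable [DecidableEq ι]

lemma raise_apply (x w : ι → ℕ) (l j : ι) :
    raise x w l j = if j = l then x j else max (x j) (w j) := by
  by_cases h : j = l
  · simp [raise, h]
  · simp [raise, h]

lemma le_raise (x w : ι → ℕ) (l : ι) : x ≤ raise x w l := by
  simp [raise, le_update_iff]

lemma almostCovers_raise (x w : ι → ℕ) (l : ι) : AlmostCovers (raise x w l) w :=
  ⟨l, fun j hj => by simp [raise_apply, hj]⟩

lemma raise_le (hxy : x ≤ y) (hw : ∀ j ≠ l, w j ≤ y j) : raise x w l ≤ y :=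
  update_le_iff.mpr ⟨hxy l, fun j hj => max_le (hxy j) (hw j hj)⟩

end Raise

section Solutions

variable {ι : Type*} [Fintype ι] {W : Finset (ι → ℕ)} {D : ℕ} {x y w : ι → ℕ}

lemma isSolution_insert :
    IsSolution (insert w W) D x ↔ IsSolution W D x ∧ AlmostCovers x w := by
  simp only [IsSolution, forall_mem_insert]
  tauto

lemma sum_le_of_le (hxy : x ≤ y) (hy : ∑ j, y j ≤ D) : ∑ j, x j ≤ D :=
  (sum_le_sum fun j _ => hxy j).trans hy

lemma minimal_isSolution_empty_iff : Minimal (IsSolution ∅ D) x ↔ x = 0 := by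
  have h0 : IsSolution ∅ D (0 : ι → ℕ) := ⟨by simp, by simp⟩
  exact ⟨fun h => le_antisymm (h.2 h0 zero_le) zero_le, by rintro rfl; exact ⟨h0, by simp⟩⟩

lemma exists_mem_insert_zero_of_minimal (hx : Minimal (IsSolution W D) x) (j : ι) :
    ∃ w ∈ insert 0 W, x j = w j := by
  classical
  by_contra! hne
  simp only [forall_mem_insert, Pi.zero_apply] at hne
  have hle : Function.update x j (x j - 1) ≤ x := by simp
  have hsol : IsSolution W D (Function.update x j (x j - 1)) := by
    refine ⟨sum_le_of_le hle hx.1.1, fun w hw => (hx.1.2 w hw).imp fun l hl i hi => ?_⟩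
    obtain rfl | hij := eq_or_ne i j
    · simpa using Nat.le_sub_one_of_lt ((hl i hi).lt_of_ne (hne.2 w hw).symm)
    · simpa [hij] using hl i hi
  have := hx.2 hsol hle j
  simp only [Function.update_self] at this
  omega

variable [DecidableEq ι]

lemma IsSolution.exists_raise_le (hy : IsSolution (insert w W) D y) :
    ∃ x l, Minimal (IsSolution W D) x ∧ raise x w l ≤ y := by
  obtain ⟨hyW, l, hl⟩ := isSolution_insert.mp hy
  obtain ⟨x, hxy, hx⟩ := exists_minimal_le_of_wellFoundedLT _ y hyW
  exact ⟨x, l, hx, raise_le hxy hl⟩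

lemma IsSolution.raise {l : ι} (hx : IsSolution W D x) (hD : ∑ j, raise x w l j ≤ D) :
    IsSolution (insert w W) D (raise x w l) :=
  isSolution_insert.mpr
    ⟨⟨hD, fun v hv => (hx.2 v hv).mono (le_raise x w l)⟩, almostCovers_raise x w l⟩

theorem minimal_isSolution_insert_iff :
    Minimal (IsSolution (insert w W) D) y ↔
      ∑ j, y j ≤ D ∧ Minimal (fun y => ∃ x l, Minimal (IsSolution W D) x ∧ raise x w l = y) y := by
  constructor
  · intro hy
    have le_of_raise_le {x : ι → ℕ} {l : ι} (hx : Minimal (IsSolution W D) x)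
        (hle : BudgetDivision.raise x w l ≤ y) : y ≤ BudgetDivision.raise x w l :=
      hy.2 (hx.1.raise (sum_le_of_le hle hy.1.1)) hle
    obtain ⟨x, l, hx, hle⟩ := hy.1.exists_raise_le
    refine ⟨hy.1.1, ⟨x, l, hx, hle.antisymm (le_of_raise_le hx hle)⟩, ?_⟩
    rintro _ ⟨x', l', hx', rfl⟩ hle'
    exact le_of_raise_le hx' hle'
  · rintro ⟨hD, ⟨x, l, hx, rfl⟩, hmin⟩
    refine ⟨hx.1.raise hD, fun z hz hzy => ?_⟩
    obtain ⟨x', l', hx', hle⟩ := hz.exists_raise_le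
    exact (hmin ⟨x', l', hx', rfl⟩ (hle.trans hzy)).trans hle

end Solutions

section Conflict

variable {ι : Type*} {w x y : ι → ℕ} {a b : ι}

lemma Conflict.symm (h : Conflict w x y a b) : Conflict w y x b a :=
  ⟨h.ne.symm, h.right_lt, h.left_lt, h.le_right, h.le_left⟩

lemma AlmostCovers.inf_or_conflict (hx : AlmostCovers x w) (hy : AlmostCovers y w) :
    AlmostCovers (x ⊓ y) w ∨ ∃ a b, Conflict w x y a b := by
  obtain ⟨a, ha⟩ := hx
  obtain ⟨b, hb⟩ := hy
  by_cases hxa : w a ≤ x a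
  · refine .inl ⟨b, fun j hj => le_inf ?_ (hb j hj)⟩
    obtain rfl | hja := eq_or_ne j a
    exacts [hxa, ha j hja]
  by_cases hyb : w b ≤ y b
  · refine .inl ⟨a, fun j hj => le_inf (ha j hj) ?_⟩
    obtain rfl | hjb := eq_or_ne j b
    exacts [hyb, hb j hjb]
  obtain rfl | hab := eq_or_ne a b
  · exact .inl ⟨a, fun j hj => le_inf (ha j hj) (hb j hj)⟩
  · exact .inr ⟨a, b, hab, not_le.mp hxa, not_le.mp hyb, ha, hb⟩

lemma Conflict.sum_le [Fintype ι] (h : Conflict w x y a b) :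
    ∑ j, w j ≤ ∑ j, (x ⊓ y) j + (y a - x a) + (x b - y b) := by
  classical
  calc ∑ j, w j
      ≤ ∑ j, ((x ⊓ y) j + (if j = a then y a - x a else 0) + (if j = b then x b - y b else 0)) := by
        refine sum_le_sum fun j _ => ?_
        obtain rfl | hja := eq_or_ne j a
        · have := h.le_right j h.ne
          simp only [Pi.inf_apply, if_pos, h.ne, if_false]
          omega
        obtain rfl | hjb := eq_or_ne j b
        · have := h.le_left j hja
          simp only [Pi.inf_apply, if_pos, hja, if_false]
          omega
        · simpa [hja, hjb] using ⟨h.le_left j hja, h.le_right j hjb⟩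
    _ = ∑ j, (x ⊓ y) j + (y a - x a) + (x b - y b) := by simp [sum_add_distrib]

end Conflict

lemma exists_disjoint_or_star {α β : Type*} [Nonempty α] (R : α → β → Prop) :
    (∃ a b a' b', R a b ∧ R a' b' ∧ a ≠ a' ∧ b ≠ b') ∨
      (∃ a, ∀ a' b, R a' b → a' = a) ∨ ∃ b, ∀ a b', R a b' → b' = b := by
  by_contra! h
  obtain ⟨hdisj, hleft, hright⟩ := h
  obtain ⟨a₁, b₁, h₁, -⟩ := hleft (Classical.arbitrary α)
  obtain ⟨a₂, b₂, h₂, ha₂⟩ := hleft a₁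
  obtain ⟨a₃, b₃, h₃, hb₃⟩ := hright b₁
  grind

section Exceeds

variable {ι : Type*} [Fintype ι] {W : Finset (ι → ℕ)} {D : ℕ} {x y : ι → ℕ}

@[simp] lemma mem_exceeds {j : ι} : j ∈ exceeds x y ↔ x j < y j := by simp [exceeds]

lemma exceeds_nonempty (hx : Minimal (IsSolution W D) x) (hy : IsSolution W D y) (hne : x ≠ y) :
    (exceeds x y).Nonempty := by
  by_contra! h
  have hyx : y ≤ x := fun j => not_lt.mp fun hj => by simpa [h] using mem_exceeds.mpr hj
  exact hne ((hx.2 hy hyx).antisymm hyx)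

lemma exceeds_subset_of_conflict_eq (hx : IsSolution W D x) (hy : Minimal (IsSolution W D) y)
    {a : ι} (ha : ∀ w ∈ W, ∀ a' b, Conflict w x y a' b → a' = a) : exceeds x y ⊆ {a} := by
  classical
  set z := Function.update (x ⊓ y) a (y a)
  have hzy : z ≤ y := update_le_iff.mpr ⟨le_rfl, fun _ _ => inf_le_right⟩
  have hz : x ⊓ y ≤ z := le_update_iff.mpr ⟨inf_le_right, fun _ _ => le_rfl⟩
  have hsol : IsSolution W D z := by
    refine ⟨sum_le_of_le hzy hy.1.1, fun w hw => ?_⟩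
    obtain h | ⟨a', b, h⟩ := (hx.2 w hw).inf_or_conflict (hy.1.2 w hw)
    · exact h.mono hz
    · obtain rfl := ha w hw a' b h
      refine ⟨b, fun j hj => ?_⟩
      obtain rfl | hja := eq_or_ne j a'
      · simpa [z] using h.le_right j hj
      · simpa [z, hja] using ⟨h.le_left j hja, h.le_right j hj⟩
  intro j hj
  by_contra hja
  have hyx : y j ≤ x j := by simpa [z, mem_singleton.not.mp hja] using hy.2 hsol hzy j
  exact (mem_exceeds.mp hj).not_ge hyx

/-- The increments of two disjoint conflicts add up to all that the budget leaves free above the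
common lower bound `x ⊓ y`, so that `y` exceeds `x` nowhere else. -/
lemma exceeds_subset_of_disjoint_conflicts [DecidableEq ι] {w w' : ι → ℕ} {a b a' b' : ι}
    (hx : ∑ j, x j ≤ D) (hy : ∑ j, y j ≤ D) (hw : ∑ j, w j = D) (hw' : ∑ j, w' j = D)
    (h : Conflict w x y a b) (h' : Conflict w' x y a' b') (haa : a ≠ a') (hbb : b ≠ b') :
    exceeds x y ⊆ {a, a'} := by
  have sum_inf_add (u v : ι → ℕ) : ∑ j, (u ⊓ v) j + ∑ j, (v j - u j) = ∑ j, v j := by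
    rw [← sum_add_distrib]
    exact sum_congr rfl fun j _ => by simp only [Pi.inf_apply]; omega
  have hxy := sum_inf_add x y
  have hyx := sum_inf_add y x
  rw [inf_comm] at hyx
  have hb : x b - y b + (x b' - y b') ≤ ∑ j, (x j - y j) := by
    rw [← sum_pair (f := fun j => x j - y j) hbb]
    exact sum_le_sum_of_subset (subset_univ _)
  intro j hj
  by_contra hmem
  have ha : y j - x j + (y a - x a + (y a' - x a')) ≤ ∑ j, (y j - x j) := by
    rw [← sum_pair (f := fun j => y j - x j) haa,
      ← sum_insert (f := fun j => y j - x j) hmem]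
    exact sum_le_sum_of_subset (subset_univ _)
  have := mem_exceeds.mp hj
  have := h.sum_le
  have := h'.sum_le
  omega

theorem card_exceeds_le_two (hW : ∀ w ∈ W, ∑ j, w j = D) (hx : Minimal (IsSolution W D) x)
    (hy : Minimal (IsSolution W D) y) (hne : x ≠ y) :
    #(exceeds x y) ≤ 2 ∨ #(exceeds y x) ≤ 2 := by
  classical
  have : Nonempty ι := (exceeds_nonempty hx hy.1 hne).to_type
  obtain ⟨a, b, a', b', ⟨w, hw, h⟩, ⟨w', hw', h'⟩, haa, hbb⟩ | ⟨a, ha⟩ | ⟨b, hb⟩ :=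
    exists_disjoint_or_star fun a b => ∃ w ∈ W, Conflict w x y a b
  · exact .inl ((card_le_card (exceeds_subset_of_disjoint_conflicts hx.1.1 hy.1.1 (hW w hw)
      (hW w' hw') h h' haa hbb)).trans card_le_two)
  · have := exceeds_subset_of_conflict_eq hx.1 hy fun w hw a' b h => ha a' b ⟨w, hw, h⟩
    exact .inl ((card_le_card this).trans (by simp))
  · have := exceeds_subset_of_conflict_eq hy.1 hx fun w hw b' a h => hb a b' ⟨w, hw, h.symm⟩
    exact .inr ((card_le_card this).trans (by simp))

end Exceeds

section Counting

theorem card_le_of_diagonal {K α : Type*} [Field K] {F : Finset α} {f : α → α → K}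
    {Φ : Finset (α → K)} (hself : ∀ x ∈ F, f x x ≠ 0)
    (hoff : ∀ x ∈ F, ∀ y ∈ F, x ≠ y → f x y = 0)
    (hspan : ∀ x ∈ F, f x ∈ Submodule.span K (Φ : Set (α → K))) : #F ≤ #Φ := by
  have hli : LinearIndependent K fun x : F => f x := by
    refine Fintype.linearIndependent_iff.mpr fun g hg x => ?_
    have hx : ∑ y : F, g y * f y x = 0 := by simpa using congrFun hg x
    rw [sum_eq_single x (fun y _ hyx => by simp [hoff y y.2 x x.2 (Subtype.coe_ne_coe.mpr hyx)])
      (by simp)] at hx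
    exact (mul_eq_zero.mp hx).resolve_right (hself x x.2)
  simpa using linearIndependent_le_span_aux' _ hli (Φ : Set (α → K))
    (Set.range_subset_iff.mpr fun x => hspan x x.2)

variable {ι : Type*}

/-- The function that indicates whether coordinate `j` exceeds `t`. -/
def aboveIndicator (j : ι) (t : ℕ) (y : ι → ℕ) : ℚ := if t < y j then 1 else 0

/-- The function that indicates whether coordinate `j` stays below `t`. -/
def belowIndicator (j : ι) (t : ℕ) (y : ι → ℕ) : ℚ := if y j < t then 1 else 0

variable [Fintype ι]

open Classical in
/-- The constant function `1` and the indicator functions for all thresholds that can occur as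
coordinates of a minimal solution. -/
noncomputable def thresholdIndicators (W : Finset (ι → ℕ)) : Finset ((ι → ℕ) → ℚ) :=
  insert 1 ((univ ×ˢ insert 0 W).image (fun p => aboveIndicator p.1 (p.2 p.1)) ∪
    (univ ×ˢ insert 0 W).image (fun p => belowIndicator p.1 (p.2 p.1)))

/-- A function of `y` that vanishes if and only if `y` exceeds `x`, or `x` exceeds `y`, in exactly
one or two coordinates. -/
def separator (x y : ι → ℕ) : ℚ :=
  (#(exceeds x y) - 1) * (#(exceeds x y) - 2) * (#(exceeds y x) - 1) * (#(exceeds y x) - 2)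

variable {W : Finset (ι → ℕ)} {D : ℕ} {x y : ι → ℕ}

lemma card_thresholdIndicators_le (W : Finset (ι → ℕ)) :
    #(thresholdIndicators W) ≤ 2 * (Fintype.card ι * (#W + 1)) + 1 := by
  classical
  have hprod : #((univ : Finset ι) ×ˢ insert 0 W) ≤ Fintype.card ι * (#W + 1) := by
    rw [card_product, card_univ]
    gcongr
    exact card_insert_le 0 W
  calc #(thresholdIndicators W)
      ≤ #((univ : Finset ι) ×ˢ insert 0 W) + #((univ : Finset ι) ×ˢ insert 0 W) + 1 :=
        (card_insert_le _ _).trans (Nat.add_le_add_right ((card_union_le _ _).trans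
          (add_le_add card_image_le card_image_le)) 1)
    _ ≤ 2 * (Fintype.card ι * (#W + 1)) + 1 := by omega

lemma one_mem_thresholdIndicators : 1 ∈ thresholdIndicators W := by
  simp [thresholdIndicators]

lemma aboveIndicator_mem_thresholdIndicators (hx : Minimal (IsSolution W D) x) (j : ι) :
    aboveIndicator j (x j) ∈ thresholdIndicators W := by
  classical
  obtain ⟨w, hw, h⟩ := exists_mem_insert_zero_of_minimal hx j
  exact mem_insert_of_mem (mem_union_left _
    (mem_image.mpr ⟨(j, w), by simpa using hw, by simp [h]⟩))

lemma belowIndicator_mem_thresholdIndicators (hx : Minimal (IsSolution W D) x) (j : ι) :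
    belowIndicator j (x j) ∈ thresholdIndicators W := by
  classical
  obtain ⟨w, hw, h⟩ := exists_mem_insert_zero_of_minimal hx j
  exact mem_insert_of_mem (mem_union_right _
    (mem_image.mpr ⟨(j, w), by simpa using hw, by simp [h]⟩))

lemma card_exceeds_eq_sum_aboveIndicator (x y : ι → ℕ) :
    (#(exceeds x y) : ℚ) = ∑ j, aboveIndicator j (x j) y := by
  simp [exceeds, aboveIndicator]

lemma card_exceeds_eq_sum_belowIndicator (x y : ι → ℕ) :
    (#(exceeds y x) : ℚ) = ∑ j, belowIndicator j (x j) y := by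
  simp [exceeds, belowIndicator]

open Pointwise in
lemma separator_mem_span (hx : Minimal (IsSolution W D) x) [DecidableEq ((ι → ℕ) → ℚ)] :
    separator x ∈
      Submodule.span ℚ ((thresholdIndicators W ^ 4 : Finset _) : Set ((ι → ℕ) → ℚ)) := by
  set M := Submodule.span ℚ (thresholdIndicators W : Set ((ι → ℕ) → ℚ)) with hM
  have hone : 1 ∈ M := Submodule.subset_span one_mem_thresholdIndicators
  have htwo : 2 ∈ M := by simpa [one_add_one_eq_two] using M.add_mem hone hone
  have hup : (fun y => (#(exceeds x y) : ℚ)) ∈ M := by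
    have := M.sum_mem (t := univ) fun j _ =>
      Submodule.subset_span (aboveIndicator_mem_thresholdIndicators hx j)
    convert this
    simp [card_exceeds_eq_sum_aboveIndicator]
  have hdown : (fun y => (#(exceeds y x) : ℚ)) ∈ M := by
    have := M.sum_mem (t := univ) fun j _ =>
      Submodule.subset_span (belowIndicator_mem_thresholdIndicators hx j)
    convert this
    simp [card_exceeds_eq_sum_belowIndicator]
  rw [coe_pow, ← Submodule.span_pow, ← hM, pow_succ, pow_succ, pow_succ, pow_one]
  exact Submodule.mul_mem_mul (Submodule.mul_mem_mul (Submodule.mul_mem_mul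
    (M.sub_mem hup hone) (M.sub_mem hup htwo)) (M.sub_mem hdown hone)) (M.sub_mem hdown htwo)

lemma separator_self (x : ι → ℕ) : separator x x = 4 := by
  have : exceeds x x = ∅ := by simp [exceeds]
  norm_num [separator, this]

lemma separator_eq_zero (hW : ∀ w ∈ W, ∑ j, w j = D) (hx : Minimal (IsSolution W D) x)
    (hy : Minimal (IsSolution W D) y) (hne : x ≠ y) : separator x y = 0 := by
  have one_or_two {s : Finset ι} (hs : s.Nonempty) (h : #s ≤ 2) : #s = 1 ∨ #s = 2 := by
    have := hs.card_pos
    omega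
  obtain h | h := card_exceeds_le_two hW hx hy hne
  · obtain h | h := one_or_two (exceeds_nonempty hx hy.1 hne) h <;> simp [separator, h]
  · obtain h | h := one_or_two (exceeds_nonempty hy hx.1 hne.symm) h <;> simp [separator, h]

open Pointwise in
theorem card_minimal_le (hW : ∀ w ∈ W, ∑ j, w j = D) {F : Finset (ι → ℕ)}
    (hF : ∀ x ∈ F, Minimal (IsSolution W D) x) :
    #F ≤ (2 * (Fintype.card ι * (#W + 1)) + 1) ^ 4 := by
  classical
  calc #F ≤ #(thresholdIndicators W ^ 4) :=
        card_le_of_diagonal (f := separator) (fun x _ => by simp [separator_self])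
          (fun x hx y hy => separator_eq_zero hW (hF x hx) (hF y hy))
          fun x hx => separator_mem_span (hF x hx)
    _ ≤ #(thresholdIndicators W) ^ 4 := card_pow_le
    _ ≤ _ := Nat.pow_le_pow_left (card_thresholdIndicators_le W) 4

end Counting

section Enumeration

/-- The list `L` consists of the objects with property `P`, each of them occurring once. -/
def Enumerates {α : Type*} (L : List α) (P : α → Prop) : Prop := L.Nodup ∧ ∀ x, x ∈ L ↔ P x

/-- In a search for the minimal values of `f`, the candidate `p` is superseded by `q` if `f q` is
smaller than `f p`, or if the two values are equal and `q` comes first. -/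
def Supersedes {α : Type*} [LE α] (f : ℕ → α) (q p : ℕ) : Prop :=
  f q ≤ f p ∧ (f p ≤ f q → q < p)

theorem enumerates_map_filter_range {α : Type*} [PartialOrder α] (f : ℕ → α) (N : ℕ) (R : α → Prop)
    [DecidablePred R] [DecidableRel (Supersedes f)] :
    Enumerates (((List.range N).filter fun p => R (f p) ∧ ∀ q < N, ¬Supersedes f q p).map f)
      fun y => R y ∧ Minimal (fun z => ∃ p < N, f p = z) y := by
  refine ⟨List.Nodup.map_on ?_ (List.nodup_range.filter _), fun y => ?_⟩
  · intro p hp q hq hpq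
    simp only [List.mem_filter, List.mem_range, decide_eq_true_eq] at hp hq
    by_contra hne
    obtain h | h := Nat.lt_or_gt_of_ne hne
    · exact hq.2.2 p hp.1 ⟨hpq.le, fun _ => h⟩
    · exact hp.2.2 q hq.1 ⟨hpq.ge, fun _ => h⟩
  simp only [List.mem_map, List.mem_filter, List.mem_range, decide_eq_true_eq]
  constructor
  · rintro ⟨p, ⟨hp, hR, hmin⟩, rfl⟩
    refine ⟨hR, ⟨p, hp, rfl⟩, ?_⟩
    rintro _ ⟨q, hq, rfl⟩ hle
    by_contra hnle
    exact hmin q hq ⟨hle, fun h => absurd h hnle⟩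
  · classical
    rintro ⟨hR, hy⟩
    obtain ⟨hp, hfp⟩ := Nat.find_spec hy.1
    refine ⟨Nat.find hy.1, ⟨hp, hfp.symm ▸ hR, fun q hq ⟨hle, hlt⟩ => ?_⟩, hfp⟩
    rw [hfp] at hle hlt
    have hyq := hy.2 ⟨q, hq, rfl⟩ hle
    exact Nat.find_min hy.1 (hlt hyq) ⟨hq, hle.antisymm hyq⟩

variable {ι : Type*} [Fintype ι] {W : Finset (ι → ℕ)} {D : ℕ} {L : List (ι → ℕ)}

lemma Enumerates.length_le (hL : Enumerates L (Minimal (IsSolution W D)))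
    (hW : ∀ w ∈ W, ∑ j, w j = D) : L.length ≤ (2 * (Fintype.card ι * (#W + 1)) + 1) ^ 4 := by
  classical
  rw [← List.toFinset_card_of_nodup hL.1]
  exact card_minimal_le hW fun x hx => (hL.2 x).mp (List.mem_toFinset.mp hx)

theorem Enumerates.insert [DecidableEq ι] {w : ι → ℕ} (hL : Enumerates L (Minimal (IsSolution W D)))
    {f : ℕ → ι → ℕ} [DecidableRel (Supersedes f)] {N : ℕ}
    (hf : ∀ y, (∃ p < N, f p = y) ↔ ∃ x ∈ L, ∃ l, raise x w l = y) :
    Enumerates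
      (((List.range N).filter fun p => ∑ j, f p j ≤ D ∧ ∀ q < N, ¬Supersedes f q p).map f)
      (Minimal (IsSolution (insert w W) D)) := by
  have hraise (y : ι → ℕ) : (∃ p < N, f p = y) ↔
      ∃ x l, Minimal (IsSolution W D) x ∧ raise x w l = y := by
    simp only [hf, hL.2, exists_and_left]
  have h := enumerates_map_filter_range f N fun y => ∑ j, y j ≤ D
  refine ⟨h.1, fun y => ?_⟩
  rw [h.2, minimal_isSolution_insert_iff]
  simp only [hraise]

end Enumeration

end BudgetDivision

/-! ### Programs of polynomial cost -/

namespace RAM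

open Polynomial

/-- All memory contents have at most `B` bits. -/
def State.Bounded (B : ℕ) (s : State) : Prop :=
  (∀ v, s.var v < 2 ^ B) ∧ ∀ a i, s.arr a i < 2 ^ B

/-- A bound for the bit length of the value of a term, as a polynomial in the bit length of the
memory contents. -/
noncomputable def Term.sizePoly : Term → ℕ[X]
  | .lit n => (n.size : ℕ[X])
  | .var _ => X
  | .arr _ _ => X
  | .add x y => x.sizePoly + y.sizePoly + 1
  | .sub x _ => x.sizePoly
  | .mul x y => x.sizePoly + y.sizePoly
  | .div x _ => x.sizePoly

/-- A bound for the cost of evaluating a term, as a polynomial in the bit length of the memory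
contents. -/
noncomputable def Term.costPoly : Term → ℕ[X]
  | .lit n => 1 + (n.size : ℕ[X])
  | .var _ => 1 + X
  | .arr _ i => i.costPoly + (1 + X)
  | .add x y => x.costPoly + y.costPoly + (1 + (x.add y).sizePoly)
  | .sub x y => x.costPoly + y.costPoly + (1 + (x.sub y).sizePoly)
  | .mul x y => x.costPoly + y.costPoly + (1 + (x.mul y).sizePoly)
  | .div x y => x.costPoly + y.costPoly + (1 + (x.div y).sizePoly)

/-- A bound for the running time of a program, as a polynomial in a common bound for the bit length
of the memory contents and the number of iterations of each loop. -/
noncomputable def Program.timePoly : Program → ℕ[X]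
  | .skip => 1
  | .assign _ x => x.costPoly + 1
  | .store _ i x => i.costPoly + x.costPoly + 1
  | .seq c₁ c₂ => c₁.timePoly + c₂.timePoly
  | .ite x c₁ c₂ => x.costPoly + 1 + (c₁.timePoly + c₂.timePoly)
  | .loop x c => X * (x.costPoly + 1 + c.timePoly) + (x.costPoly + 1)

section Cost

variable {B : ℕ} {s : State}

lemma Term.eval_lt_two_pow (hs : s.Bounded B) (x : Term) : x.eval s < 2 ^ x.sizePoly.eval B := by
  induction x with
  | lit n => simpa [sizePoly, RAM.Term.eval] using n.lt_size_self
  | var v => simpa [sizePoly, RAM.Term.eval] using hs.1 v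
  | arr a i _ => simpa [sizePoly, RAM.Term.eval] using hs.2 a (i.eval s)
  | add x y hx hy =>
    have hx' := hx.trans_le (Nat.pow_le_pow_right two_pos (Nat.le_add_right _ (y.sizePoly.eval B)))
    have hy' := hy.trans_le (Nat.pow_le_pow_right two_pos (Nat.le_add_left _ (x.sizePoly.eval B)))
    simp only [sizePoly, RAM.Term.eval, eval_add, eval_one, pow_succ, mul_two]
    exact Nat.add_lt_add hx' hy'
  | sub x y hx _ => exact (Nat.sub_le _ _).trans_lt hx
  | mul x y hx hy =>
    simpa only [sizePoly, RAM.Term.eval, eval_add, pow_add] using Nat.mul_lt_mul'' hx hy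
  | div x y hx _ => exact (Nat.div_le_self _ _).trans_lt hx

lemma Term.cost_le (hs : s.Bounded B) (x : Term) : x.cost s ≤ x.costPoly.eval B := by
  have size_le (y : Term) : (y.eval s).size ≤ y.sizePoly.eval B :=
    Nat.size_le.mpr (y.eval_lt_two_pow hs)
  induction x with
  | lit n => simp [cost, costPoly]
  | var v => simpa [cost, costPoly, sizePoly, RAM.Term.eval] using size_le (.var v)
  | arr a i hi =>
    simpa [cost, costPoly, sizePoly, RAM.Term.eval] using
      add_le_add hi (add_le_add_right (size_le (.arr a i)) 1)
  | add x y hx hy =>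
    simpa [cost, costPoly, RAM.Term.eval] using
      add_le_add (add_le_add hx hy) (add_le_add_right (size_le (x.add y)) 1)
  | sub x y hx hy =>
    simpa [cost, costPoly, RAM.Term.eval] using
      add_le_add (add_le_add hx hy) (add_le_add_right (size_le (x.sub y)) 1)
  | mul x y hx hy =>
    simpa [cost, costPoly, RAM.Term.eval] using
      add_le_add (add_le_add hx hy) (add_le_add_right (size_le (x.mul y)) 1)
  | div x y hx hy =>
    simpa [cost, costPoly, RAM.Term.eval] using
      add_le_add (add_le_add hx hy) (add_le_add_right (size_le (x.div y)) 1)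

end Cost

@[simp] lemma State.setVar_var (s : State) (v n w : ℕ) :
    (s.setVar v n).var w = if w = v then n else s.var w := by
  simp [State.setVar, Function.update_apply]

@[simp] lemma State.setVar_arr (s : State) (v n : ℕ) : (s.setVar v n).arr = s.arr := rfl

@[simp] lemma State.setArr_arr (s : State) (a i n b j : ℕ) :
    (s.setArr a i n).arr b j = if b = a ∧ j = i then n else s.arr b j := by
  by_cases hb : b = a
  · subst hb
    simp [State.setArr, Function.update_apply]
  · simp [State.setArr, hb]

lemma State.Bounded.setVar {B : ℕ} {s : State} (hs : s.Bounded B) (v : ℕ) {n : ℕ}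
    (hn : n < 2 ^ B) : (s.setVar v n).Bounded B := by
  refine ⟨fun w => ?_, hs.2⟩
  rw [State.setVar_var]
  split_ifs
  exacts [hn, hs.1 w]

lemma State.Bounded.setArr {B : ℕ} {s : State} (hs : s.Bounded B) (a i : ℕ) {n : ℕ}
    (hn : n < 2 ^ B) : (s.setArr a i n).Bounded B := by
  refine ⟨hs.1, fun b j => ?_⟩
  rw [State.setArr_arr]
  split_ifs
  exacts [hn, hs.2 b j]

/-- The resource-bounded weakest precondition: `c.wp B Q s` says that the program `c`, started in
`s`, halts in a state with `Q`, while it writes only numbers of at most `B` bits and runs through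
each loop at most `B` times whenever it enters it. Loops come with an invariant that may refer to
the number of completed iterations. -/
def Program.wp (B : ℕ) : Program → (State → Prop) → State → Prop
  | .skip, Q, s => Q s
  | .assign v x, Q, s => x.eval s < 2 ^ B ∧ Q (s.setVar v (x.eval s))
  | .store a i x, Q, s => x.eval s < 2 ^ B ∧ Q (s.setArr a (i.eval s) (x.eval s))
  | .seq c₁ c₂, Q, s => c₁.wp B (c₂.wp B Q) s
  | .ite x c₁ c₂, Q, s => (x.eval s ≠ 0 → c₁.wp B Q s) ∧ (x.eval s = 0 → c₂.wp B Q s)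
  | .loop x c, Q, s => ∃ (N : ℕ) (Inv : ℕ → State → Prop), N ≤ B ∧ Inv 0 s ∧
      (∀ t < N, ∀ s', Inv t s' → x.eval s' ≠ 0 ∧ c.wp B (Inv (t + 1)) s') ∧
      ∀ s', Inv N s' → x.eval s' = 0 ∧ Q s'

/-- The registers that a program may change. -/
def Program.vars : Program → List ℕ
  | .skip => []
  | .assign v _ => [v]
  | .store _ _ _ => []
  | .seq c₁ c₂ => c₁.vars ++ c₂.vars
  | .ite _ c₁ c₂ => c₁.vars ++ c₂.vars
  | .loop _ c => c.vars

/-- The arrays that a program may change. -/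
def Program.arrs : Program → List ℕ
  | .skip => []
  | .assign _ _ => []
  | .store a _ _ => [a]
  | .seq c₁ c₂ => c₁.arrs ++ c₂.arrs
  | .ite _ c₁ c₂ => c₁.arrs ++ c₂.arrs
  | .loop _ c => c.arrs

/-- The states `s` and `s'` agree on everything that the program `c` does not write. -/
structure Program.Frame (c : Program) (s s' : State) : Prop where
  var : ∀ v, v ∉ c.vars → s'.var v = s.var v
  arr : ∀ a, a ∉ c.arrs → s'.arr a = s.arr a

namespace Program

variable {B : ℕ} {c c₁ c₂ : Program} {P Q : State → Prop} {s s' s'' : State}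

lemma Frame.refl (c : Program) (s : State) : c.Frame s s := ⟨fun _ _ => rfl, fun _ _ => rfl⟩

lemma Frame.trans (h : c.Frame s s') (h' : c.Frame s' s'') : c.Frame s s'' :=
  ⟨fun v hv => (h'.var v hv).trans (h.var v hv), fun a ha => (h'.arr a ha).trans (h.arr a ha)⟩

lemma Frame.mono (h : c.Frame s s') (hv : c.vars ⊆ c₁.vars) (ha : c.arrs ⊆ c₁.arrs) :
    c₁.Frame s s' :=
  ⟨fun v h' => h.var v fun h'' => h' (hv h''), fun a h' => h.arr a fun h'' => h' (ha h'')⟩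

/-- The rule of consequence together with the frame rule. -/
theorem wp.conseq (h : c.wp B P s) (hPQ : ∀ s', c.Frame s s' → P s' → Q s') : c.wp B Q s := by
  induction c generalizing P Q s with
  | skip => exact hPQ s (.refl _ s) h
  | assign v x =>
    refine ⟨h.1, hPQ _ ⟨fun w hw => ?_, fun _ _ => rfl⟩ h.2⟩
    simp_all [vars]
  | store a i x =>
    refine ⟨h.1, hPQ _ ⟨fun _ _ => rfl, fun b hb => ?_⟩ h.2⟩
    ext j
    simp_all [arrs]
  | seq c₁ c₂ ih₁ ih₂ =>
    exact ih₁ h fun s₁ f₁ h₁ => ih₂ h₁ fun s₂ f₂ h₂ => hPQ s₂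
      ((f₁.mono (by simp [vars]) (by simp [arrs])).trans
        (f₂.mono (by simp [vars]) (by simp [arrs]))) h₂
  | ite x c₁ c₂ ih₁ ih₂ =>
    exact ⟨fun hx => ih₁ (h.1 hx) fun s' f => hPQ s' (f.mono (by simp [vars]) (by simp [arrs])),
      fun hx => ih₂ (h.2 hx) fun s' f => hPQ s' (f.mono (by simp [vars]) (by simp [arrs]))⟩
  | loop x c ih =>
    obtain ⟨N, Inv, hN, h0, hstep, hend⟩ := h
    refine ⟨N, fun t s' => (loop x c).Frame s s' ∧ Inv t s', hN, ⟨.refl _ s, h0⟩,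
      fun t ht s₁ ⟨f₁, h₁⟩ => ?_, fun s₁ ⟨f₁, h₁⟩ => ?_⟩
    · obtain ⟨hx, hc⟩ := hstep t ht s₁ h₁
      exact ⟨hx, ih hc fun s₂ f₂ h₂ => ⟨f₁.trans ⟨f₂.var, f₂.arr⟩, h₂⟩⟩
    · exact ⟨(hend s₁ h₁).1, hPQ s₁ f₁ (hend s₁ h₁).2⟩

lemma exists_exec_loop {x : Term} {N T t : ℕ} (Inv : ℕ → State → Prop)
    (hstep : ∀ t < N, ∀ s, s.Bounded B → Inv t s → x.eval s ≠ 0 ∧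
      ∃ s' u, Exec c s s' u ∧ u ≤ T ∧ s'.Bounded B ∧ Inv (t + 1) s')
    (hend : ∀ s, Inv N s → x.eval s = 0 ∧ Q s) (ht : t ≤ N) (hs : s.Bounded B) (hI : Inv t s) :
    ∃ s' u, Exec (.loop x c) s s' u ∧
      u ≤ (N - t) * (x.costPoly.eval B + 1 + T) + (x.costPoly.eval B + 1) ∧
      s'.Bounded B ∧ Q s' := by
  have hx := x.cost_le hs
  induction ht using Nat.decreasingInduction generalizing s with
  | self =>
    obtain ⟨hx0, hQ⟩ := hend s hI
    exact ⟨s, _, .loopDone hx0, by omega, hs, hQ⟩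
  | of_succ t ht ih =>
    obtain ⟨hx0, s₁, u₁, e₁, l₁, b₁, h₁⟩ := hstep t ht s hs hI
    obtain ⟨s₂, u₂, e₂, l₂, b₂, h₂⟩ := ih b₁ h₁ (x.cost_le b₁)
    refine ⟨s₂, _, .loopStep hx0 e₁ e₂, ?_, b₂, h₂⟩
    rw [show N - t = N - (t + 1) + 1 by omega, add_mul, one_mul]
    omega

theorem wp.exec (h : c.wp B Q s) (hs : s.Bounded B) :
    ∃ s' t, Exec c s s' t ∧ t ≤ c.timePoly.eval B ∧ s'.Bounded B ∧ Q s' := by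
  induction c generalizing Q s with
  | skip => exact ⟨s, 1, .skip s, by simp [timePoly], hs, h⟩
  | assign v x =>
    exact ⟨_, _, .assign v x s, by simpa [timePoly] using x.cost_le hs, hs.setVar v h.1, h.2⟩
  | store a i x =>
    exact ⟨_, _, .store a i x s,
      by simpa [timePoly] using add_le_add (i.cost_le hs) (x.cost_le hs), hs.setArr a _ h.1, h.2⟩
  | seq c₁ c₂ ih₁ ih₂ =>
    obtain ⟨s₁, t₁, e₁, l₁, b₁, h₁⟩ := ih₁ h hs
    obtain ⟨s₂, t₂, e₂, l₂, b₂, h₂⟩ := ih₂ h₁ b₁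
    exact ⟨s₂, _, .seq e₁ e₂, by simpa [timePoly] using add_le_add l₁ l₂, b₂, h₂⟩
  | ite x c₁ c₂ ih₁ ih₂ =>
    have hx := x.cost_le hs
    by_cases h0 : x.eval s = 0
    · obtain ⟨s', t, e, l, b, h'⟩ := ih₂ (h.2 h0) hs
      exact ⟨s', _, .iteFalse h0 e, by simp only [timePoly, eval_add, eval_one]; omega, b, h'⟩
    · obtain ⟨s', t, e, l, b, h'⟩ := ih₁ (h.1 h0) hs
      exact ⟨s', _, .iteTrue h0 e, by simp only [timePoly, eval_add, eval_one]; omega, b, h'⟩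
  | loop x c ih =>
    obtain ⟨N, Inv, hN, h0, hstep, hend⟩ := h
    obtain ⟨s', u, e, l, b, hQ⟩ := exists_exec_loop Inv
      (fun t ht s₁ b₁ h₁ => ⟨(hstep t ht s₁ h₁).1, ih (hstep t ht s₁ h₁).2 b₁⟩) hend
      N.zero_le hs h0
    refine ⟨s', u, e, l.trans ?_, b, hQ⟩
    simp only [timePoly, eval_add, eval_mul, eval_X, eval_one, Nat.sub_zero]
    gcongr

end Program

instance : Add Term := ⟨.add⟩
instance : Sub Term := ⟨.sub⟩
instance : Mul Term := ⟨.mul⟩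
instance : Div Term := ⟨.div⟩
instance (n : ℕ) : OfNat Term n := ⟨.lit n⟩

infix:55 " ≔ " => Program.assign
infixr:50 " ;; " => Program.seq

namespace Term

instance : Mod Term := ⟨fun x y => x - x / y * y⟩

/-- A term with value `0` or `1`, according to whether `x` and `y` have the same value. -/
def distinct (x y : Term) : Term := 1 - (1 - ((x - y) + (y - x)))

variable (s : State) (x y : Term)

@[simp] lemma eval_ofNat (n : ℕ) : (no_index (OfNat.ofNat n) : Term).eval s = OfNat.ofNat n := rfl
@[simp] lemma eval_var (v : ℕ) : (Term.var v).eval s = s.var v := rfl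
@[simp] lemma eval_arr (a : ℕ) : (Term.arr a x).eval s = s.arr a (x.eval s) := rfl
@[simp] lemma eval_add : (x + y).eval s = x.eval s + y.eval s := rfl
@[simp] lemma eval_sub : (x - y).eval s = x.eval s - y.eval s := rfl
@[simp] lemma eval_mul : (x * y).eval s = x.eval s * y.eval s := rfl
@[simp] lemma eval_div : (x / y).eval s = x.eval s / y.eval s := rfl
@[simp] lemma eval_mod : (x % y).eval s = x.eval s % y.eval s := Nat.mod_eq_sub_div_mul.symm

@[simp] lemma eval_distinct : (distinct x y).eval s = if x.eval s = y.eval s then 0 else 1 := by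
  simp only [distinct, eval_sub, eval_add, eval_ofNat]
  split_ifs <;> omega

end Term

/-- The state after writing `f 0, …, f (N - 1)` into the cells `o, …, o + N - 1` of array `a`. -/
def State.setCells (s : State) (a o : ℕ) (f : ℕ → ℕ) (N : ℕ) : State :=
  { s with arr := Function.update s.arr a fun i =>
      if o ≤ i ∧ i < o + N then f (i - o) else s.arr a i }

namespace State

variable (s : State) (a o : ℕ) (f : ℕ → ℕ) (N : ℕ)

@[simp] lemma setCells_var : (s.setCells a o f N).var = s.var := rfl

@[simp] lemma setCells_arr_of_ne {b : ℕ} (hb : b ≠ a) :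
    (s.setCells a o f N).arr b = s.arr b := by
  simp [setCells, hb]

lemma setCells_arr (i : ℕ) :
    (s.setCells a o f N).arr a i = if o ≤ i ∧ i < o + N then f (i - o) else s.arr a i := by
  simp [setCells]

lemma setCells_zero : s.setCells a o f 0 = s := by
  have h (i : ℕ) : ¬(o ≤ i ∧ i < o) := by omega
  simp [setCells, h]

lemma setArr_setCells :
    (s.setCells a o f N).setArr a (o + N) (f N) = s.setCells a o f (N + 1) := by
  simp only [setArr, setCells, Function.update_self, Function.update_idem, State.mk.injEq, true_and]
  congr 1
  ext i
  simp only [Function.update_apply]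
  grind

lemma setVar_comm {v w : ℕ} (hvw : v ≠ w) (x y : ℕ) :
    (s.setVar v x).setVar w y = (s.setVar w y).setVar v x := by
  simp [setVar, Function.update_comm hvw]

lemma setVar_setVar (v x y : ℕ) : (s.setVar v x).setVar v y = s.setVar v y := by
  simp [setVar]

end State

namespace Program

/-- `forTo v b c` executes `c` with register `v` running from `0` to `b - 1`. -/
def forTo (v : ℕ) (b : Term) (c : Program) : Program :=
  v ≔ 0 ;; .loop (b - .var v) (c ;; v ≔ .var v + 1)

/-- `recTo r x v b y` sets register `r` to `x` and then updates it to `y` for each value of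
register `v` from `0` to `b - 1`. -/
def recTo (r : ℕ) (x : Term) (v : ℕ) (b y : Term) : Program :=
  r ≔ x ;; forTo v b (r ≔ y)

/-- `sumTo r v b x` sets register `r` to the sum of `x` over the values of register `v` from `0`
to `b - 1`. -/
def sumTo (r v : ℕ) (b x : Term) : Program := recTo r 0 v b (.var r + x)

/-- `fillTo a o v b x` writes the values of `x`, with register `v` running from `0` to `b - 1`, to
consecutive cells of array `a` from cell `o` on. -/
def fillTo (a : ℕ) (o : Term) (v : ℕ) (b x : Term) : Program :=
  forTo v b (.store a (o + .var v) x)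

variable {B N : ℕ} {Q : State → Prop} {s : State} {v r a : ℕ} {b x y o : Term} {c : Program}

lemma wp_forTo (Inv : ℕ → State → Prop) (hN : N ≤ B) (hv : v ∉ c.vars)
    (h0 : Inv 0 (s.setVar v 0))
    (hb : ∀ t s', (forTo v b c).Frame s s' → s'.var v = t → Inv t s' → b.eval s' = N)
    (hstep : ∀ t < N, ∀ s', (forTo v b c).Frame s s' → s'.var v = t → Inv t s' →
      c.wp B (fun s'' => Inv (t + 1) (s''.setVar v (t + 1))) s')
    (hQ : ∀ s', (forTo v b c).Frame s s' → s'.var v = N → Inv N s' → Q s') :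
    (forTo v b c).wp B Q s := by
  have hlt {t : ℕ} (ht : t ≤ N) : t < 2 ^ B := (ht.trans hN).trans_lt Nat.lt_two_pow_self
  have hvars {w : ℕ} (hw : w ∉ (forTo v b c).vars) : w ≠ v ∧ w ∉ c.vars := by
    simp_all [forTo, vars]
  have harrs {i : ℕ} (hi : i ∉ (forTo v b c).arrs) : i ∉ c.arrs := by
    simp_all [forTo, arrs]
  refine ⟨by simp, N, fun t s' => (forTo v b c).Frame s s' ∧ s'.var v = t ∧ Inv t s', hN,
    ⟨⟨fun w hw => by simp [hvars hw], fun _ _ => rfl⟩, by simp, h0⟩, ?_, ?_⟩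
  · rintro t ht s₁ ⟨f₁, hv₁, h₁⟩
    refine ⟨by simpa [hb _ s₁ f₁ hv₁ h₁, hv₁] using (by omega : N - t ≠ 0), ?_⟩
    refine (hstep t ht s₁ f₁ hv₁ h₁).conseq fun s₂ f₂ h₂ => ?_
    have hv₂ : s₂.var v = t := (f₂.var v hv).trans hv₁
    refine ⟨by simpa [hv₂] using hlt ht, ⟨fun w hw => ?_, fun i hi => ?_⟩, by simp [hv₂], ?_⟩
    · simpa [hvars hw, f₂.var w (hvars hw).2] using f₁.var w hw
    · simpa [f₂.arr i (harrs hi)] using f₁.arr i hi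
    · simpa [hv₂] using h₂
  · rintro s₁ ⟨f₁, hv₁, h₁⟩
    exact ⟨by simp [hb _ s₁ f₁ hv₁ h₁, hv₁], hQ s₁ f₁ hv₁ h₁⟩

lemma wp_recTo (g : ℕ → ℕ) (hN : N ≤ B) (hg : ∀ t ≤ N, g t < 2 ^ B) (hrv : r ≠ v)
    (hb : ∀ t, b.eval ((s.setVar r (g t)).setVar v t) = N) (hx : x.eval s = g 0)
    (hy : ∀ t < N, y.eval ((s.setVar r (g t)).setVar v t) = g (t + 1))
    (hQ : Q ((s.setVar r (g N)).setVar v N)) : (recTo r x v b y).wp B Q s := by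
  have h0 : (s.setVar r (x.eval s)).setVar v 0 = (s.setVar r (g 0)).setVar v 0 := by rw [hx]
  refine ⟨hx ▸ hg 0 N.zero_le, wp_forTo (fun t s' => s' = (s.setVar r (g t)).setVar v t) hN
    (by simpa [vars] using hrv.symm) h0 (fun t s' _ _ h => h ▸ hb t) (fun t ht s' _ _ h => ?_)
    fun s' _ _ h => h ▸ hQ⟩
  subst h
  refine ⟨hy t ht ▸ hg _ ht, ?_⟩
  rw [hy t ht]
  simp [State.setVar_comm _ hrv, State.setVar_setVar]

lemma wp_sumTo (f : ℕ → ℕ) (hN : N ≤ B) (hf : ∑ t ∈ Finset.range N, f t < 2 ^ B) (hrv : r ≠ v)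
    (hb : ∀ k t, b.eval ((s.setVar r k).setVar v t) = N)
    (hx : ∀ k, ∀ t < N, x.eval ((s.setVar r k).setVar v t) = f t)
    (hQ : Q ((s.setVar r (∑ t ∈ Finset.range N, f t)).setVar v N)) :
    (sumTo r v b x).wp B Q s := by
  refine wp_recTo (fun t => ∑ i ∈ Finset.range t, f i) hN (fun t ht => ?_) hrv (fun _ => hb _ _)
    (by simp) (fun t ht => ?_) hQ
  · exact (Finset.sum_le_sum_of_subset (Finset.range_mono ht)).trans_lt hf
  · simp [hx _ t ht, hrv, Finset.sum_range_succ]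

lemma wp_fillTo {k : ℕ} (f : ℕ → ℕ) (hN : N ≤ B) (hf : ∀ t < N, f t < 2 ^ B)
    (hb : ∀ t, b.eval ((s.setCells a k f t).setVar v t) = N)
    (ho : ∀ t, o.eval ((s.setCells a k f t).setVar v t) = k)
    (hx : ∀ t < N, x.eval ((s.setCells a k f t).setVar v t) = f t)
    (hQ : Q ((s.setCells a k f N).setVar v N)) : (fillTo a o v b x).wp B Q s := by
  refine wp_forTo (fun t s' => s' = (s.setCells a k f t).setVar v t) hN (by simp [vars])
    (by rw [State.setCells_zero]) (fun t s' _ _ h => h ▸ hb t) (fun t ht s' _ _ h => ?_)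
    fun s' _ _ h => h ▸ hQ
  subst h
  refine ⟨hx t ht ▸ hf t ht, ?_⟩
  rw [hx t ht, Term.eval_add, ho, Term.eval_var]
  simp [← State.setArr_setCells, State.setVar, State.setArr]

end Program

/-- A decision problem, with the promise that the instances are `valid`, can be decided in time
polynomial in the (binary) length of the input, by a single program. -/
def PolyTimeDecidable {α : Type} (encode : α → List ℕ) (valid answer : α → Prop) : Prop :=
  ∃ (c : Program) (p : Polynomial ℕ), ∀ a, valid a →
    DecidesWithin c (encode a) (p.eval (inputLength (encode a))) (answer a)

section PolyTime

variable {α : Type} {encode : α → List ℕ} {valid answer : α → Prop}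

lemma polynomial_eval_mono (p : Polynomial ℕ) : Monotone fun x => p.eval x := by
  intro x y hxy
  simp only [Polynomial.eval_eq_sum, Polynomial.sum]
  gcongr

theorem PolyTimeDecidable.pseudoPolyTimeDecidable (h : PolyTimeDecidable encode valid answer) :
    PseudoPolyTimeDecidable encode valid answer := by
  obtain ⟨c, p, hc⟩ := h
  refine ⟨c, p, fun a ha => ?_⟩
  obtain ⟨s, t, hexec, ht, hs⟩ := hc a ha
  exact ⟨s, t, hexec, ht.trans (polynomial_eval_mono p (Nat.le_add_right _ _)), hs⟩

lemma length_le_inputLength (l : List ℕ) : l.length ≤ inputLength l := by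
  simp [inputLength]

lemma getD_lt_two_pow_inputLength (l : List ℕ) (i : ℕ) : l.getD i 0 < 2 ^ inputLength l := by
  obtain hi | hi := lt_or_ge i l.length
  · rw [List.getD_eq_getElem _ _ hi, ← Nat.size_le]
    exact (Nat.le_succ _).trans
      (List.single_le_sum (fun _ _ => Nat.zero_le _) _ (List.mem_map_of_mem (List.getElem_mem hi)))
  · rw [List.getD_eq_default _ _ hi]
    exact Nat.two_pow_pos _

lemma bounded_initialState (l : List ℕ) : (initialState l).Bounded (inputLength l) := by
  refine ⟨fun v => ?_, fun a i => ?_⟩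
  · simp only [initialState]
    split_ifs
    exacts [(length_le_inputLength l).trans_lt Nat.lt_two_pow_self, by simp]
  · simp only [initialState]
    split_ifs
    exacts [getD_lt_two_pow_inputLength l i, by simp]

lemma State.Bounded.mono {s : State} {A B : ℕ} (hs : s.Bounded A) (hAB : A ≤ B) : s.Bounded B :=
  have hpow : 2 ^ A ≤ 2 ^ B := Nat.pow_le_pow_right two_pos hAB
  ⟨fun v => (hs.1 v).trans_le hpow, fun a i => (hs.2 a i).trans_le hpow⟩

theorem polyTimeDecidable_of_wp (c : Program) (q : Polynomial ℕ) (hq : ∀ x, x ≤ q.eval x)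
    (hc : ∀ a, valid a → c.wp (q.eval (inputLength (encode a)))
      (fun s => (answer a → s.var 0 = 1) ∧ (¬answer a → s.var 0 = 0)) (initialState (encode a))) :
    PolyTimeDecidable encode valid answer := by
  refine ⟨c, c.timePoly.comp q, fun a ha => ?_⟩
  obtain ⟨s, t, hexec, ht, -, hs⟩ :=
    (hc a ha).exec ((bounded_initialState (encode a)).mono (hq _))
  exact ⟨s, t, hexec, by rwa [Polynomial.eval_comp], hs⟩

end PolyTime

end RAM

/-! ### The algorithm -/

namespace BudgetDivision

open RAM RAM.Program

/-- Row `r` of a matrix with `m` columns that is stored row by row in an array. -/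
def row (m : ℕ) (A : ℕ → ℕ) (r : ℕ) : Fin m → ℕ := fun j => A (r * m + j)

/-- The first `k` rows of a matrix with `m` columns that is stored row by row in an array. -/
def rows (m : ℕ) (A : ℕ → ℕ) (k : ℕ) : List (Fin m → ℕ) := (List.range k).map (row m A)

namespace Reg

abbrev answer : ℕ := 0
abbrev agents : ℕ := 1
abbrev projects : ℕ := 2
abbrev scale : ℕ := 3
abbrev solutions : ℕ := 4
abbrev agent : ℕ := 5
abbrev kept : ℕ := 6
abbrev candidate : ℕ := 7
abbrev other : ℕ := 8
abbrev cell : ℕ := 9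
abbrev above : ℕ := 10
abbrev below : ℕ := 11
abbrev cost : ℕ := 12
abbrev superseded : ℕ := 13

end Reg

namespace Arr

abbrev input : ℕ := 0
abbrev solution : ℕ := 1
abbrev raised : ℕ := 2
abbrev demand : ℕ := 3

end Arr

open Reg Arr

/-- Reads the instance, and scales the demands to integers by the product of all denominators. -/
def loadDemands : Program :=
  agents ≔ .arr input 0 ;;
  projects ≔ .arr input 1 ;;
  recTo scale 1 cell (.var agents * .var projects) (.var scale * .arr input (3 + 2 * .var cell)) ;;
  fillTo demand 0 cell (.var agents * .var projects)
    (.arr input (2 + 2 * .var cell) * (.var scale / .arr input (3 + 2 * .var cell)))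

/-- Lists all vectors that arise by raising a stored solution to the demands of the current agent
in all coordinates but one: row `r * projects + l` is solution `r`, raised in all coordinates
but `l`. -/
def raiseSolutions : Program :=
  fillTo raised 0 cell (.var solutions * .var projects * .var projects)
    (.arr solution (.var cell / .var projects / .var projects * .var projects +
        .var cell % .var projects) +
      .distinct (.var cell % .var projects) (.var cell / .var projects % .var projects) *
      (.arr demand (.var agent * .var projects + .var cell % .var projects) -
        .arr solution (.var cell / .var projects / .var projects * .var projects +
          .var cell % .var projects)))

/-- Marks the current candidate if it is superseded by the other one. -/
def compareCandidates : Program :=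
  sumTo above cell (.var projects)
    (.arr raised (.var other * .var projects + .var cell) -
      .arr raised (.var candidate * .var projects + .var cell)) ;;
  sumTo below cell (.var projects)
    (.arr raised (.var candidate * .var projects + .var cell) -
      .arr raised (.var other * .var projects + .var cell)) ;;
  .ite (.var above) .skip
    (.ite (.var below + (.var candidate - .var other)) (superseded ≔ 1) .skip)

/-- Marks the current candidate if it is superseded by any other one. -/
def searchSuperseding : Program :=
  superseded ≔ 0 ;; forTo other (.var solutions * .var projects) compareCandidates

/-- Stores the current candidate as a solution for the agents up to the current one if it respects
the budget and is minimal. -/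
def keepIfMinimal : Program :=
  sumTo cost cell (.var projects) (.arr raised (.var candidate * .var projects + .var cell)) ;;
  searchSuperseding ;;
  .ite (.var cost - .var scale + .var superseded) .skip
    (fillTo solution (.var kept * .var projects) cell (.var projects)
        (.arr raised (.var candidate * .var projects + .var cell)) ;;
      kept ≔ .var kept + 1)

/-- Replaces the stored solutions by the minimal ones among the raised solutions that respect the
budget. -/
def selectMinimal : Program :=
  kept ≔ 0 ;;
  forTo candidate (.var solutions * .var projects) keepIfMinimal ;;
  solutions ≔ .var kept

/-- Passes from the minimal solutions for the previous agents to those that take the current agent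
into account as well. -/
def processAgent : Program := raiseSolutions ;; selectMinimal

/-- Decides whether all agents can be satisfied for all projects but one. The zero vector is the
only minimal solution at the start. -/
def decideSat : Program :=
  loadDemands ;;
  solutions ≔ 1 ;;
  forTo agent (.var agents) processAgent ;;
  answer ≔ 1 - (1 - .var solutions)

section Correctness

variable {B D m i k p q : ℕ} {s : State}

lemma sum_row (m : ℕ) (A : ℕ → ℕ) (r : ℕ) :
    ∑ j ∈ Finset.range m, A (r * m + j) = ∑ j, row m A r j :=
  Finset.sum_range _

lemma sum_tsub_eq_zero_iff {x y : Fin m → ℕ} : ∑ j, (x j - y j) = 0 ↔ x ≤ y := by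
  simp [Finset.sum_eq_zero_iff, Pi.le_def, Nat.sub_eq_zero_iff_le]

lemma sum_lt_two_pow (hD : m * D < 2 ^ B) {f : ℕ → ℕ} (hf : ∀ j : Fin m, f j ≤ D) :
    ∑ j ∈ Finset.range m, f j < 2 ^ B := by
  refine lt_of_le_of_lt ?_ hD
  rw [Finset.sum_range]
  simpa using Finset.sum_le_card_nsmul Finset.univ (fun j : Fin m => f j) D fun j _ => hf j

lemma wp_compareCandidates (hB0 : 0 < B) (hB : m ≤ B) (hD : m * D < 2 ^ B) (hm : s.var projects = m)
    (hp : s.var candidate = p) (hq : s.var other = q)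
    (hpD : ∀ j, row m (s.arr raised) p j ≤ D) (hqD : ∀ j, row m (s.arr raised) q j ≤ D) :
    compareCandidates.wp B (fun s' => s'.var superseded = 0 ↔
      s.var superseded = 0 ∧ ¬Supersedes (row m (s.arr raised)) q p) s := by
  set f := row m (s.arr raised)
  refine wp_sumTo (fun j => s.arr raised (q * m + j) - s.arr raised (p * m + j)) hB
    (sum_lt_two_pow hD fun j => (Nat.sub_le _ _).trans (hqD j)) (by decide) (by simp [hm])
    (by simp [hm, hp, hq]) ?_
  refine wp_sumTo (fun j => s.arr raised (p * m + j) - s.arr raised (q * m + j)) hB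
    (sum_lt_two_pow hD fun j => (Nat.sub_le _ _).trans (hpD j)) (by decide) (by simp [hm])
    (by simp [hm, hp, hq]) ?_
  have habove : ∑ j ∈ Finset.range m, (s.arr raised (q * m + j) - s.arr raised (p * m + j)) = 0 ↔
      f q ≤ f p := by
    rw [Finset.sum_range, ← sum_tsub_eq_zero_iff]; rfl
  have hbelow : ∑ j ∈ Finset.range m, (s.arr raised (p * m + j) - s.arr raised (q * m + j)) = 0 ↔
      f p ≤ f q := by
    rw [Finset.sum_range, ← sum_tsub_eq_zero_iff]; rfl
  generalize ∑ j ∈ Finset.range m, (s.arr raised (q * m + j) - s.arr raised (p * m + j)) = u at *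
  generalize ∑ j ∈ Finset.range m, (s.arr raised (p * m + j) - s.arr raised (q * m + j)) = v at *
  rw [Supersedes, ← habove, ← hbelow]
  refine ⟨fun hu => ?_, fun hu => ⟨fun hv => ⟨?_, ?_⟩, fun hv => ?_⟩⟩
  · have hu0 : u ≠ 0 := by simpa using hu
    simp [Program.wp, hu0]
  · simpa using hB0.ne'
  all_goals
    have hu0 : u = 0 := by simpa using hu
  · have hv0 : v + (p - q) ≠ 0 := by simpa [hp, hq] using hv
    simpa [hu0] using fun _ _ => (by omega : q < p)
  · have hv0 : v = 0 ∧ p ≤ q := by simpa [hp, hq, Nat.sub_eq_zero_iff_le] using hv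
    simp [Program.wp, hu0, hv0]

lemma wp_searchSuperseding {N : ℕ} (hB0 : 0 < B) (hB : m ≤ B) (hD : m * D < 2 ^ B) (hN : N ≤ B)
    (hm : s.var projects = m) (hk : s.var solutions * m = N) (hp : s.var candidate = p)
    (hpN : p < N) (hND : ∀ q < N, ∀ j, row m (s.arr raised) q j ≤ D) :
    searchSuperseding.wp B (fun s' => s'.var superseded = 0 ↔
      ∀ q < N, ¬Supersedes (row m (s.arr raised)) q p) s := by
  refine ⟨by simp, wp_forTo (fun t s' => s'.var superseded = 0 ↔
    ∀ q < t, ¬Supersedes (row m (s.arr raised)) q p) hN (by decide) (by simp) ?_ ?_ ?_⟩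
  · intro t s' f _ _
    simp +decide [f.var, hm, hk]
  · intro t ht s' f hq h
    have hraised : s'.arr raised = s.arr raised := f.arr _ (by decide)
    refine (wp_compareCandidates hB0 hB hD (by simp +decide [f.var, hm])
      (by simp +decide [f.var, hp]) hq (hraised ▸ hND p hpN) (hraised ▸ hND t ht)).conseq ?_
    intro s'' _ h'
    rw [Nat.forall_lt_succ_right, ← h, ← hraised]
    simpa using h'
  · exact fun _ _ _ h => h

lemma rows_succ (m : ℕ) (A : ℕ → ℕ) (k : ℕ) : rows m A (k + 1) = rows m A k ++ [row m A k] := by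
  simp [rows, List.range_succ]

lemma row_setCells_self (s : State) (a k : ℕ) (f : ℕ → ℕ) :
    row m ((s.setCells a (k * m) f m).arr a) k = fun j : Fin m => f j := by
  ext j
  simp [row, State.setCells_arr]

lemma rows_setCells_self (s : State) (a k : ℕ) (f : ℕ → ℕ) :
    rows m ((s.setCells a (k * m) f m).arr a) k = rows m (s.arr a) k := by
  refine List.map_congr_left fun r hr => funext fun j => ?_
  have hlt : r * m + j < k * m := by
    have := Nat.mul_le_mul_right m (List.mem_range.mp hr)
    rw [Nat.succ_mul] at this
    omega
  simp [row, State.setCells_arr, hlt.not_ge]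

open Classical in
lemma wp_keepIfMinimal {N : ℕ} (hB0 : 0 < B) (hB : m ≤ B) (hD : m * D < 2 ^ B) (hN : N ≤ B)
    (hm : s.var projects = m) (hscale : s.var scale = D) (hk : s.var solutions * m = N)
    (hp : s.var candidate = p) (hpN : p < N) (hkept : s.var kept ≤ p)
    (hND : ∀ q < N, ∀ j, row m (s.arr raised) q j ≤ D) :
    keepIfMinimal.wp B (fun s' => rows m (s'.arr solution) (s'.var kept) =
      rows m (s.arr solution) (s.var kept) ++
        if ∑ j, row m (s.arr raised) p j ≤ D ∧ ∀ q < N, ¬Supersedes (row m (s.arr raised)) q p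
        then [row m (s.arr raised) p] else []) s := by
  refine wp_sumTo (fun j => s.arr raised (p * m + j)) hB (sum_lt_two_pow hD (hND p hpN))
    (by decide) (by simp [hm]) (by simp [hm, hp]) ?_
  rw [sum_row]
  refine (wp_searchSuperseding hB0 hB hD hN (by simp [hm]) (by simpa using hk) (by simpa using hp)
    hpN (by simpa using hND)).conseq fun s' f h => ⟨fun htest => ?_, fun htest => ?_⟩
  all_goals
    have hm' : s'.var projects = m := by simp +decide [f.var, hm]
    have hp' : s'.var candidate = p := by simp +decide [f.var, hp]
    have hkept' : s'.var kept = s.var kept := by simp +decide [f.var]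
    have hsolution : s'.arr solution = s.arr solution := f.arr _ (by decide)
    have hraised : s'.arr raised = s.arr raised := f.arr _ (by decide)
    have hcost : s'.var cost = ∑ j, row m (s.arr raised) p j := by simp +decide [f.var]
    have hscale' : s'.var scale = D := by simp +decide [f.var, hscale]
    have hiff : (Term.var cost - .var scale + .var superseded).eval s' = 0 ↔
        ∑ j, row m (s.arr raised) p j ≤ D ∧ ∀ q < N, ¬Supersedes (row m (s.arr raised)) q p := by
      simp [hcost, hscale', h, Nat.sub_eq_zero_iff_le]
  · rw [if_neg (mt hiff.mpr htest)]
    simp [Program.wp, hkept', hsolution]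
  · have hlt : s.var kept + 1 < 2 ^ B :=
      (Nat.succ_le_of_lt (hkept.trans_lt hpN)).trans_lt (hN.trans_lt Nat.lt_two_pow_self)
    refine wp_fillTo (k := s.var kept * m) (fun j => s.arr raised (p * m + j)) hB (fun j hj => ?_)
      (by simp [hm']) (by simp [hkept', hm']) (fun j _ => ?_) ⟨?_, ?_⟩
    · exact (hND p hpN ⟨j, hj⟩).trans_lt ((Nat.le_mul_of_pos_left D (by omega)).trans_lt hD)
    · simp [hp', hm', hraised]
    · simpa [hkept'] using hlt
    · rw [if_pos (hiff.mp htest)]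
      have hrow : row m (s.arr raised) p = fun j : Fin m => s.arr raised (p * m + j) := rfl
      simp [hkept', hsolution, hrow, rows_succ, rows_setCells_self, row_setCells_self]

open Classical in
lemma wp_selectMinimal {N : ℕ} (hB0 : 0 < B) (hB : m ≤ B) (hD : m * D < 2 ^ B) (hN : N ≤ B)
    (hm : s.var projects = m) (hscale : s.var scale = D) (hk : s.var solutions * m = N)
    (hND : ∀ q < N, ∀ j, row m (s.arr raised) q j ≤ D) :
    selectMinimal.wp B (fun s' => rows m (s'.arr solution) (s'.var solutions) =
      ((List.range N).filter fun p => ∑ j, row m (s.arr raised) p j ≤ D ∧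
        ∀ q < N, ¬Supersedes (row m (s.arr raised)) q p).map (row m (s.arr raised))) s := by
  set f := row m (s.arr raised)
  let Inv (t : ℕ) (s' : State) : Prop := rows m (s'.arr solution) (s'.var kept) =
    ((List.range t).filter fun p => ∑ j, f p j ≤ D ∧ ∀ q < N, ¬Supersedes f q p).map f
  have kept_le {t : ℕ} {s' : State} (h : Inv t s') : s'.var kept ≤ t := by
    have hlength := congrArg List.length h
    simp only [rows, List.length_map, List.length_range] at hlength
    exact hlength.trans_le ((List.length_filter_le _ _).trans_eq List.length_range)
  refine ⟨by simp, wp_forTo Inv hN (by decide) (by simp [Inv, rows]) ?_ ?_ ?_⟩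
  · intro t s' f' _ _
    simp +decide [f'.var, hm, hk]
  · intro t ht s' f' ht' h
    have hraised : s'.arr raised = s.arr raised := f'.arr _ (by decide)
    refine (wp_keepIfMinimal hB0 hB hD hN (by simp +decide [f'.var, hm])
      (by simp +decide [f'.var, hscale]) (by simp +decide [f'.var, hk]) ht' ht (kept_le h)
      (hraised ▸ hND)).conseq fun s'' _ h' => ?_
    change rows m (s''.arr solution) (s''.var kept) = _
    rw [h', hraised, h, List.range_succ, List.filter_append, List.map_append, List.filter_singleton,
      Bool.cond_decide, apply_ite (List.map f)]
    rfl
  · intro s' _ _ h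
    exact ⟨(kept_le h).trans_lt (hN.trans_lt Nat.lt_two_pow_self), by simpa [Inv] using h⟩

lemma exists_index (hp : p < k * m) : ∃ r < k, ∃ l : Fin m, r * m + l = p := by
  have hm : 0 < m := Nat.pos_of_mul_pos_left (Nat.zero_lt_of_lt hp)
  exact ⟨p / m, Nat.div_lt_of_lt_mul (by rwa [mul_comm] at hp), ⟨p % m, p.mod_lt hm⟩,
    Nat.div_add_mod' p m⟩

lemma index_lt {r : ℕ} (hr : r < k) (l : Fin m) : r * m + l < k * m :=
  (Nat.add_lt_add_left l.2 _).trans_le (by simpa [Nat.succ_mul] using Nat.mul_le_mul_right m hr)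

lemma raise_le_of_le {x w : Fin m → ℕ} (hx : ∀ j, x j ≤ D) (hw : ∀ j, w j ≤ D) (l j : Fin m) :
    raise x w l j ≤ D := by
  rw [raise_apply]
  split_ifs
  exacts [hx j, max_le (hx j) (hw j)]

lemma wp_raiseSolutions (hB : k * m * m ≤ B) (hD : m * D < 2 ^ B) (hm : s.var projects = m)
    (hk : s.var solutions = k) (hi : s.var agent = i)
    (hsolution : ∀ r < k, ∀ j, row m (s.arr solution) r j ≤ D)
    (hdemand : ∀ j, row m (s.arr demand) i j ≤ D) :
    raiseSolutions.wp B (fun s' => ∀ r < k, ∀ l : Fin m, row m (s'.arr raised) (r * m + l) =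
      raise (row m (s.arr solution) r) (row m (s.arr demand) i) l) s := by
  set f : ℕ → ℕ := fun t => s.arr solution (t / m / m * m + t % m) +
    (if t % m = t / m % m then 0 else 1) *
      (s.arr demand (i * m + t % m) - s.arr solution (t / m / m * m + t % m)) with hf
  have hraise {r : ℕ} (l j : Fin m) : f ((r * m + l) * m + j) =
      raise (row m (s.arr solution) r) (row m (s.arr demand) i) l j := by
    have hm0 : 0 < m := l.pos
    have hdiv (a : ℕ) (b : Fin m) : (a * m + b) / m = a := by
      rw [Nat.mul_comm, Nat.mul_add_div hm0, Nat.div_eq_of_lt b.2, add_zero]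
    have hmod (a : ℕ) (b : Fin m) : (a * m + b) % m = b := by
      rw [Nat.mul_comm, Nat.mul_add_mod, Nat.mod_eq_of_lt b.2]
    simp only [hf, hdiv, hmod, raise_apply, row, Fin.ext_iff]
    split_ifs <;> omega
  refine wp_fillTo (k := 0) f hB (fun t ht => ?_) (by simp [hk, hm]) (by simp) (fun t _ => ?_) ?_
  · obtain ⟨p, hp, j, rfl⟩ := exists_index ht
    obtain ⟨r, hr, l, rfl⟩ := exists_index hp
    rw [hraise]
    exact (raise_le_of_le (hsolution r hr) hdemand l j).trans_lt
      ((Nat.le_mul_of_pos_left D l.pos).trans_lt hD)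
  · simp [hf, hm, hi]
  · intro r hr l
    ext j
    rw [← hraise l j]
    simp [row, State.setCells_arr, index_lt (index_lt hr l) j]

theorem wp_processAgent {W : Finset (Fin m → ℕ)} (hB0 : 0 < B) (hB : m ≤ B) (hkB : k * m * m ≤ B)
    (hD : m * D < 2 ^ B) (hm : s.var projects = m) (hscale : s.var scale = D)
    (hk : s.var solutions = k) (hi : s.var agent = i)
    (hL : Enumerates (rows m (s.arr solution) k) (Minimal (IsSolution W D)))
    (hdemand : ∑ j, row m (s.arr demand) i j = D) :
    processAgent.wp B (fun s' => Enumerates (rows m (s'.arr solution) (s'.var solutions))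
      (Minimal (IsSolution (insert (row m (s.arr demand) i) W) D))) s := by
  classical
  have le_of_sum_le {x : Fin m → ℕ} (hx : ∑ j, x j ≤ D) (j : Fin m) : x j ≤ D :=
    (Finset.single_le_sum (fun _ _ => Nat.zero_le _) (Finset.mem_univ j)).trans hx
  have hsolution (r : ℕ) (hr : r < k) : ∀ j, row m (s.arr solution) r j ≤ D :=
    le_of_sum_le ((hL.2 _).mp (List.mem_map_of_mem (List.mem_range.mpr hr))).1.1
  have hkm : k * m ≤ B :=
    (Nat.mul_le_mul_left k (Nat.le_mul_self m)).trans (by rwa [← Nat.mul_assoc])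
  refine (wp_raiseSolutions hkB hD hm hk hi hsolution (le_of_sum_le hdemand.le)).conseq
    fun s₁ f₁ h₁ => ?_
  have hraised (y : Fin m → ℕ) : (∃ p < k * m, row m (s₁.arr raised) p = y) ↔
      ∃ x ∈ rows m (s.arr solution) k, ∃ l, raise x (row m (s.arr demand) i) l = y := by
    simp only [rows, List.mem_map, List.mem_range, exists_exists_and_eq_and]
    constructor
    · rintro ⟨p, hp, rfl⟩
      obtain ⟨r, hr, l, rfl⟩ := exists_index hp
      exact ⟨r, hr, l, (h₁ r hr l).symm⟩
    · rintro ⟨r, hr, l, rfl⟩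
      exact ⟨_, index_lt hr l, h₁ r hr l⟩
  refine (wp_selectMinimal hB0 hB hD hkm (by simp +decide [f₁.var, hm])
    (by simp +decide [f₁.var, hscale]) (by simp +decide [f₁.var, hk]) fun q hq j => ?_).conseq
      fun s₂ _ h₂ => h₂ ▸ hL.insert hraised
  obtain ⟨r, hr, l, rfl⟩ := exists_index hq
  rw [h₁ r hr]
  exact raise_le_of_le (hsolution r hr) (le_of_sum_le hdemand.le) l j

lemma wp_loadDemands {n : ℕ} {d : ℕ → ℕ} (hB : n * m ≤ B) (hn : n < 2 ^ B) (hm : m < 2 ^ B)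
    (hD : D < 2 ^ B) (hin_n : s.arr input 0 = n) (hin_m : s.arr input 1 = m)
    (hprod : ∏ t ∈ Finset.range (n * m), s.arr input (3 + 2 * t) = D)
    (hpos : ∀ t < n * m, 0 < s.arr input (3 + 2 * t))
    (hd : ∀ t < n * m, s.arr input (2 + 2 * t) * (D / s.arr input (3 + 2 * t)) = d t)
    (hdB : ∀ t < n * m, d t < 2 ^ B) :
    loadDemands.wp B (fun s' => s'.var agents = n ∧ s'.var projects = m ∧ s'.var scale = D ∧
      ∀ i < n, row m (s'.arr demand) i = row m d i) s := by
  have prod_le (t : ℕ) (ht : t ≤ n * m) :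
      ∏ u ∈ Finset.range t, s.arr input (3 + 2 * u) ≤ D := by
    rw [← hprod]
    exact Finset.prod_le_prod_of_subset_of_one_le' (Finset.range_mono ht)
      fun u hu _ => hpos u (Finset.mem_range.mp hu)
  refine ⟨by simpa [hin_n] using hn, by simpa [hin_m] using hm, ?_⟩
  refine wp_recTo (fun t => ∏ u ∈ Finset.range t, s.arr input (3 + 2 * u)) hB
    (fun t ht => (prod_le t ht).trans_lt hD) (by decide) (by simp [hin_n, hin_m]) (by simp)
    (fun t _ => by simp [Finset.prod_range_succ]) ?_
  refine wp_fillTo (k := 0) d hB hdB (by simp [hin_n, hin_m]) (by simp)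
    (fun t ht => by simp [hprod, hd t ht]) ⟨by simp [hin_n], by simp [hin_m], by simp [hprod], ?_⟩
  intro i hi
  ext j
  simp [row, State.setCells_arr, index_lt hi j]

lemma Enumerates.length_pos_iff {W : Finset (Fin m → ℕ)} {L : List (Fin m → ℕ)}
    (hL : Enumerates L (Minimal (IsSolution W D))) : 0 < L.length ↔ ∃ x, IsSolution W D x := by
  rw [List.length_pos_iff_exists_mem]
  simp only [hL.2]
  exact ⟨fun ⟨x, hx⟩ => ⟨x, hx.1⟩, exists_minimal_of_wellFoundedLT _⟩

lemma length_rows_le {n t X : ℕ} {w : ℕ → Fin m → ℕ} {A : ℕ → ℕ} (hX : n * m ≤ X) (ht : t < n)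
    (hsum : ∀ i < n, ∑ j, w i j = D)
    (hL : Enumerates (rows m A k) (Minimal (IsSolution ((Finset.range t).image w) D))) :
    k ≤ (2 * X + 1) ^ 4 := by
  have hcard : ((Finset.range t).image w).card + 1 ≤ n :=
    (Nat.succ_le_succ (Finset.card_image_le.trans_eq (Finset.card_range t))).trans ht
  have hW : ∀ v ∈ (Finset.range t).image w, ∑ j, v j = D :=
    Finset.forall_mem_image.mpr fun i hi => hsum i ((Finset.mem_range.mp hi).trans ht)
  calc k = (rows m A k).length := by simp [rows]
    _ ≤ (2 * (Fintype.card (Fin m) * (((Finset.range t).image w).card + 1)) + 1) ^ 4 :=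
        hL.length_le hW
    _ ≤ (2 * X + 1) ^ 4 := by
        gcongr
        rw [Fintype.card_fin, mul_comm]
        exact (Nat.mul_le_mul_right m hcard).trans hX

lemma wp_processAgents {n X : ℕ} {w : ℕ → Fin m → ℕ} (hX : n * m ≤ X) (hn : n ≤ X)
    (hD : D < 2 ^ X) (hB : (2 * X + 1) ^ 4 * X * X + 2 * X + 1 ≤ B) (hagents : s.var agents = n)
    (hprojects : s.var projects = m) (hscale : s.var scale = D)
    (hdemand : ∀ i < n, row m (s.arr demand) i = w i) (hsum : ∀ i < n, ∑ j, w i j = D)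
    (hL : Enumerates (rows m (s.arr solution) (s.var solutions)) (Minimal (IsSolution ∅ D))) :
    (forTo agent (.var agents) processAgent).wp B
      (fun s' => Enumerates (rows m (s'.arr solution) (s'.var solutions))
        (Minimal (IsSolution ((Finset.range n).image w) D))) s := by
  refine wp_forTo (fun t s' => Enumerates (rows m (s'.arr solution) (s'.var solutions))
    (Minimal (IsSolution ((Finset.range t).image w) D))) (by omega) (by decide) (by simpa using hL)
    (fun t s' f _ _ => by simp +decide [f.var, hagents]) (fun t ht s' f ht' hL' => ?_)
    fun _ _ _ hL' => hL'
  have harr : s'.arr demand = s.arr demand := f.arr _ (by decide)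
  have hmX : m ≤ X := (Nat.le_mul_of_pos_left m (by omega)).trans hX
  have hkB : s'.var solutions * m * m ≤ (2 * X + 1) ^ 4 * X * X :=
    Nat.mul_le_mul (Nat.mul_le_mul (length_rows_le hX ht hsum hL') hmX) hmX
  have hDB : m * D < 2 ^ B :=
    calc m * D < 2 ^ X * 2 ^ X := Nat.mul_lt_mul'' (hmX.trans_lt Nat.lt_two_pow_self) hD
      _ = 2 ^ (X + X) := (pow_add 2 X X).symm
      _ ≤ 2 ^ B := Nat.pow_le_pow_right two_pos (by omega)
  refine (wp_processAgent (by omega) (by omega) (by omega) hDB (by simp +decide [f.var, hprojects])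
    (by simp +decide [f.var, hscale]) rfl ht' hL' (by rw [harr, hdemand t ht, hsum t ht])).conseq
      fun s'' _ h => ?_
  simpa [harr, hdemand t ht, Finset.range_add_one, Finset.image_insert] using h

theorem wp_decideSat {n X : ℕ} {d : ℕ → ℕ} (hX : n * m ≤ X) (hn : n ≤ X) (hm : m < 2 ^ X)
    (hD : D < 2 ^ X) (hB : (2 * X + 1) ^ 4 * X * X + 2 * X + 1 ≤ B)
    (hin_n : s.arr input 0 = n) (hin_m : s.arr input 1 = m) (hsolution : s.arr solution = 0)
    (hprod : ∏ t ∈ Finset.range (n * m), s.arr input (3 + 2 * t) = D)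
    (hpos : ∀ t < n * m, 0 < s.arr input (3 + 2 * t))
    (hd : ∀ t < n * m, s.arr input (2 + 2 * t) * (D / s.arr input (3 + 2 * t)) = d t)
    (hsum : ∀ i < n, ∑ j, row m d i j = D) :
    decideSat.wp B (fun s' =>
      ((∃ x, IsSolution ((Finset.range n).image (row m d)) D x) → s'.var answer = 1) ∧
      ((¬∃ x, IsSolution ((Finset.range n).image (row m d)) D x) → s'.var answer = 0)) s := by
  have hXB : X ≤ B := by omega
  have hpow : 2 ^ X ≤ 2 ^ B := Nat.pow_le_pow_right two_pos hXB
  have hdB (t : ℕ) (ht : t < n * m) : d t < 2 ^ B := by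
    obtain ⟨i, hi, j, rfl⟩ := exists_index ht
    refine lt_of_le_of_lt ?_ (hD.trans_le hpow)
    rw [← hsum i hi]
    exact Finset.single_le_sum (f := row m d i) (fun _ _ => Nat.zero_le _) (Finset.mem_univ j)
  have hB1 : 1 < 2 ^ B := Nat.one_lt_two_pow (by omega)
  refine (wp_loadDemands (hX.trans hXB) (hn.trans_lt (Nat.lt_two_pow_self.trans_le hpow))
    (hm.trans_le hpow) (hD.trans_le hpow) hin_n hin_m hprod hpos hd hdB).conseq
      fun s₁ f₁ ⟨hagents, hprojects, hscale, hdemand⟩ => ⟨hB1, ?_⟩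
  have hzero : rows m (s₁.arr solution) 1 = [0] := by
    rw [f₁.arr solution (by decide), hsolution]
    rfl
  refine (wp_processAgents (s := s₁.setVar solutions 1) hX hn hD hB
    (by simpa using hagents) (by simpa using hprojects) (by simpa using hscale) hdemand hsum
    ?_).conseq fun s₂ _ hL => ⟨?_, ?_⟩
  · simp [hzero, Enumerates, minimal_isSolution_empty_iff]
  · exact (Nat.sub_le _ _).trans_lt hB1
  · rw [← hL.length_pos_iff]
    simp only [rows, List.length_map, List.length_range, Term.eval_sub, Term.eval_ofNat,
      Term.eval_var, State.setVar_var, if_true]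
    omega

end Correctness

/-! ### Instances with rational demands -/

lemma getD_flatMap_finRange {α : Type*} {n c : ℕ} (f : Fin n → List α) (hf : ∀ i, (f i).length = c)
    (i : Fin n) {j : ℕ} (hj : j < c) (d : α) :
    ((List.finRange n).flatMap f).getD (i * c + j) d = (f i).getD j d := by
  induction n with
  | zero => exact i.elim0
  | succ n ih =>
    rw [List.finRange_succ, List.flatMap_cons, List.flatMap_map]
    cases i using Fin.cases with
    | zero =>
      rw [List.getD_append _ _ _ _ (by simpa [hf] using hj)]
      simp
    | succ i =>
      have hindex : (i.succ : ℕ) * c + j = (f 0).length + (i * c + j) := by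
        rw [Fin.val_succ, hf]
        ring
      rw [hindex, List.getD_append_right _ _ _ _ (Nat.le_add_right _ _), Nat.add_sub_cancel_left]
      exact ih (fun i => f i.succ) (fun i => hf _) i

namespace Instance

variable (I : Instance)

lemma getD_encode (i : Fin I.n) (j : Fin I.m) {b : ℕ} (hb : b < 2) :
    I.encode.getD (b + 2 + 2 * (i * I.m + j)) 0 =
      [(I.demand i j).num.toNat, (I.demand i j).den].getD b 0 := by
  have hindex : b + 2 + 2 * (i * I.m + j) = i * (I.m * 2) + (j * 2 + b) + 1 + 1 := by ring
  rw [hindex, encode, List.getD_cons_succ, List.getD_cons_succ,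
    getD_flatMap_finRange (c := I.m * 2) _ (fun _ => by simp) i (by omega),
    getD_flatMap_finRange (c := 2) _ (fun _ => rfl) j hb]

lemma getD_encode_num (i : Fin I.n) (j : Fin I.m) :
    I.encode.getD (2 + 2 * (i * I.m + j)) 0 = (I.demand i j).num.toNat :=
  I.getD_encode i j (b := 0) two_pos

lemma getD_encode_den (i : Fin I.n) (j : Fin I.m) :
    I.encode.getD (3 + 2 * (i * I.m + j)) 0 = (I.demand i j).den :=
  I.getD_encode i j (b := 1) one_lt_two

lemma inputLength_encode : inputLength I.encode = I.n.size + 1 + (I.m.size + 1) +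
    ∑ i, ∑ j, ((I.demand i j).num.toNat.size + 1 + ((I.demand i j).den.size + 1)) := by
  simp only [inputLength, encode, List.map_cons, List.sum_cons, List.flatMap_def, List.map_flatten,
    List.sum_flatten, List.map_map, Function.comp_def, List.map_nil, List.sum_nil, add_zero,
    Fin.sum_univ_def, add_assoc]

/-- The product of all denominators: a common multiple that is easy to compute, and whose bit length
is at most the length of the input. -/
def scale : ℕ := ∏ i, ∏ j, (I.demand i j).den

/-- The demands, multiplied by the product of all denominators. -/
def scaledDemand (i : Fin I.n) (j : Fin I.m) : ℕ :=
  (I.demand i j).num.toNat * (I.scale / (I.demand i j).den)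

lemma mul_le_inputLength : I.n * I.m ≤ inputLength I.encode := by
  rw [inputLength_encode]
  refine le_add_left ?_
  calc I.n * I.m = ∑ i : Fin I.n, ∑ j : Fin I.m, 1 := by simp
    _ ≤ _ := by gcongr; omega

lemma m_lt_two_pow_inputLength : I.m < 2 ^ inputLength I.encode :=
  getD_lt_two_pow_inputLength I.encode 1

lemma scale_lt_two_pow_inputLength : I.scale < 2 ^ inputLength I.encode := by
  calc I.scale ≤ ∏ i, ∏ j, 2 ^ (I.demand i j).den.size := by
        unfold scale
        gcongr
        exact (Nat.lt_size_self _).le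
    _ = 2 ^ ∑ i, ∑ j, (I.demand i j).den.size := by simp only [Finset.prod_pow_eq_pow_sum]
    _ < 2 ^ inputLength I.encode := by
        refine Nat.pow_lt_pow_right one_lt_two ?_
        rw [inputLength_encode]
        refine lt_add_of_pos_of_le (by omega) ?_
        gcongr
        omega

lemma prod_getD_encode :
    ∏ t ∈ Finset.range (I.n * I.m), I.encode.getD (3 + 2 * t) 0 = I.scale := by
  rw [Finset.prod_range, ← finProdFinEquiv.prod_comp, Fintype.prod_prod_type]
  refine Finset.prod_congr rfl fun i _ => Finset.prod_congr rfl fun j _ => ?_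
  rw [← I.getD_encode_den i j]
  simp [add_comm, mul_comm]

lemma scale_pos : 0 < I.scale :=
  Finset.prod_pos fun i _ => Finset.prod_pos fun j _ => (I.demand i j).den_pos

lemma cast_scaledDemand (i : Fin I.n) (j : Fin I.m) :
    (I.scaledDemand i j : ℚ) = I.demand i j * I.scale := by
  have hdvd : (I.demand i j).den ∣ I.scale :=
    (Finset.dvd_prod_of_mem _ (Finset.mem_univ j)).trans
      (Finset.dvd_prod_of_mem (fun i => ∏ j, (I.demand i j).den) (Finset.mem_univ i))
  have hnum : ((I.demand i j).num.toNat : ℚ) = (I.demand i j).num := by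
    exact_mod_cast Int.toNat_of_nonneg (Rat.num_nonneg.mpr (I.demand_mem i j).1)
  rw [scaledDemand, Nat.cast_mul, hnum, Nat.cast_div hdvd (by simp)]
  conv_rhs => rw [← Rat.num_div_den (I.demand i j)]
  ring

variable {I}

lemma sum_scaledDemand (hI : I.Tight) (i : Fin I.n) : ∑ j, I.scaledDemand i j = I.scale := by
  have h : ((∑ j, I.scaledDemand i j : ℕ) : ℚ) = I.scale := by
    simp only [Nat.cast_sum, cast_scaledDemand, ← Finset.sum_mul, hI i, one_mul]
  exact_mod_cast h

lemma Tight.nonempty (hI : I.Tight) (i : Fin I.n) : Nonempty (Fin I.m) := by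
  by_contra! hm
  simpa using hI i

end Instance

lemma pred_le_ncard_iff {m : ℕ} [Nonempty (Fin m)] (P : Fin m → Prop) :
    m - 1 ≤ Set.ncard {j | P j} ↔ ∃ l, ∀ j ≠ l, P j := by
  have hcompl := Set.ncard_add_ncard_compl {j | P j}
  rw [Nat.card_fin] at hcompl
  rw [show m - 1 ≤ Set.ncard {j | P j} ↔ Set.ncard {j | P j}ᶜ ≤ 1 by omega,
    Set.ncard_le_one_iff_subset_singleton]
  simp only [Set.subset_def, Set.mem_compl_iff, Set.mem_ofPred_eq, Set.mem_singleton_iff]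
  exact exists_congr fun l => forall_congr' fun j => not_imp_comm

namespace Instance

variable {I : Instance}

lemma satisfied_iff [Nonempty (Fin I.m)] {x : Fin I.m → ℝ} {i : Fin I.n} :
    I.Satisfied (I.m - 1) x i ↔ ∃ l, ∀ j ≠ l, (I.demand i j : ℝ) ≤ x j :=
  pred_le_ncard_iff _

lemma demand_le_div_iff {i : Fin I.n} {j : Fin I.m} {y : ℝ} :
    (I.demand i j : ℝ) ≤ y / I.scale ↔ (I.scaledDemand i j : ℝ) ≤ y := by
  have h : (I.scaledDemand i j : ℝ) = I.demand i j * I.scale := by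
    exact_mod_cast congrArg (Rat.cast : ℚ → ℝ) (I.cast_scaledDemand i j)
  rw [h, le_div_iff₀ (by exact_mod_cast I.scale_pos)]

lemma exists_isSolution_of_allAgentsSat (hI : I.Tight) (h : I.AllAgentsSat (I.m - 1)) :
    ∃ x, IsSolution (Finset.univ.image I.scaledDemand) I.scale x := by
  obtain ⟨x, ⟨hx, hsum⟩, hsat⟩ := h
  have hD : (0 : ℝ) < I.scale := by exact_mod_cast I.scale_pos
  refine ⟨fun j => ⌊x j * I.scale⌋₊, ?_, Finset.forall_mem_image.mpr fun i _ => ?_⟩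
  · have : ∑ j, (⌊x j * I.scale⌋₊ : ℝ) ≤ I.scale :=
      calc ∑ j, (⌊x j * I.scale⌋₊ : ℝ) ≤ ∑ j, x j * I.scale :=
            Finset.sum_le_sum fun j _ => Nat.floor_le (mul_nonneg (hx j).1 hD.le)
        _ = (∑ j, x j) * I.scale := (Finset.sum_mul ..).symm
        _ ≤ I.scale := mul_le_of_le_one_left hD.le hsum
    exact_mod_cast this
  · have := hI.nonempty i
    obtain ⟨l, hl⟩ := satisfied_iff.mp (hsat i)
    refine ⟨l, fun j hj => Nat.le_floor (demand_le_div_iff.mp ?_)⟩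
    rw [mul_div_cancel_right₀ _ hD.ne']
    exact hl j hj

lemma allAgentsSat_of_isSolution (hI : I.Tight) {x : Fin I.m → ℕ}
    (hx : IsSolution (Finset.univ.image I.scaledDemand) I.scale x) : I.AllAgentsSat (I.m - 1) := by
  obtain ⟨hsum, hcovers⟩ := hx
  have hD : (0 : ℝ) < I.scale := by exact_mod_cast I.scale_pos
  have hsum' : ∑ j, (x j : ℝ) / I.scale ≤ 1 := by
    rw [← Finset.sum_div, div_le_one hD]
    exact_mod_cast hsum
  have hnonneg (j : Fin I.m) : 0 ≤ (x j : ℝ) / I.scale := by positivity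
  refine ⟨fun j => x j / I.scale, ⟨fun j => ⟨hnonneg j, ?_⟩, hsum'⟩, fun i => ?_⟩
  · exact (Finset.single_le_sum (fun j _ => hnonneg j) (Finset.mem_univ j)).trans hsum'
  · have := hI.nonempty i
    obtain ⟨l, hl⟩ := hcovers _ (Finset.mem_image_of_mem _ (Finset.mem_univ i))
    exact satisfied_iff.mpr ⟨l, fun j hj => demand_le_div_iff.mpr (by exact_mod_cast hl j hj)⟩

theorem wp_decideSat_encode (hI : I.Tight) {X B : ℕ} (hX : X = inputLength I.encode)
    (hB : (2 * X + 1) ^ 4 * X * X + 2 * X + 1 ≤ B) :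
    decideSat.wp B (fun s => (I.AllAgentsSat (I.m - 1) → s.var 0 = 1) ∧
      (¬I.AllAgentsSat (I.m - 1) → s.var 0 = 0)) (initialState I.encode) := by
  set d : ℕ → ℕ := fun t =>
    I.encode.getD (2 + 2 * t) 0 * (I.scale / I.encode.getD (3 + 2 * t) 0) with hd
  have hrow (i : Fin I.n) : row I.m d i = I.scaledDemand i := by
    ext j
    simp only [row, hd, scaledDemand, I.getD_encode_num, I.getD_encode_den]
  have himage : (Finset.range I.n).image (row I.m d) = Finset.univ.image I.scaledDemand := by
    ext v
    simp [Fin.exists_iff, ← hrow]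
  have hiff : I.AllAgentsSat (I.m - 1) ↔
      ∃ x, IsSolution ((Finset.range I.n).image (row I.m d)) I.scale x := by
    rw [himage]
    exact ⟨exists_isSolution_of_allAgentsSat hI, fun ⟨x, hx⟩ => allAgentsSat_of_isSolution hI hx⟩
  have hnm : I.n * I.m ≤ X := hX ▸ I.mul_le_inputLength
  have hn : I.n ≤ X := by
    obtain h | h := I.n.eq_zero_or_pos
    · omega
    · have := Fin.pos_iff_nonempty.mpr (hI.nonempty ⟨0, h⟩)
      exact (Nat.le_mul_of_pos_right _ this).trans hnm
  rw [hiff]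
  refine wp_decideSat hnm hn (hX ▸ I.m_lt_two_pow_inputLength) (hX ▸ I.scale_lt_two_pow_inputLength)
    hB rfl rfl rfl I.prod_getD_encode (fun t ht => ?_) (fun t _ => rfl) fun i hi => ?_
  · obtain ⟨i, hi, j, rfl⟩ := exists_index ht
    exact (I.demand ⟨i, hi⟩ j).den_pos.trans_eq (I.getD_encode_den ⟨i, hi⟩ j).symm
  · rw [hrow ⟨i, hi⟩]
    exact sum_scaledDemand hI ⟨i, hi⟩

end Instance

end BudgetDivision

theorem theorem5_general :
    RAM.PolyTimeDecidable BudgetDivision.Instance.encode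
      (fun I => I.Tight) (fun I => I.AllAgentsSat (I.m - 1)) := by
  refine RAM.polyTimeDecidable_of_wp BudgetDivision.decideSat
    ((2 * .X + 1) ^ 4 * .X * .X + 2 * .X + 1) (fun x => ?_) fun I hI => ?_
  · simp only [Polynomial.eval_add, Polynomial.eval_mul, Polynomial.eval_ofNat, Polynomial.eval_X,
      Polynomial.eval_one]
    omega
  · exact BudgetDivision.Instance.wp_decideSat_encode hI rfl (by simp)

theorem theorem5 :
    RAM.PseudoPolyTimeDecidable BudgetDivision.Instance.encode
      (fun I => I.Tight) (fun I => I.AllAgentsSat (I.m - 1)) :=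
  theorem5_general.pseudoPolyTimeDecidable
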